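/- Let $n\ge 3$, let $M^n$ be a connected smooth $n$-manifold and let $x:M^n\to\mathbb R^{n+1}$ be a locally strongly convex centroaffine hypersurface, i.e. a smooth immersion whose position vector $x(p)$ is at every point $p$ transversal to $x_*(T_pM)$, such that in the centroaffine Gauss formula $$D_Xx_*(Y)=x_*(\nabla_XY)+h(X,Y)(-\varepsilon x)$$ ($D$ the flat connection of $\mathbb R^{n+1}$) the sign $\varepsilon\in\{1,-1\}$ can be, and is, chosen so that the centroaffine metric $h$ is positive definite. Let $\hat\nabla$ be the Levi-Civita connection of $h$, $K_XY=\nabla_XY-\hat\nabla_XY$ the difference tensor, and $T$ the Tchebychev vector field, given by $h(T,X)=\frac1n\operatorname{Tr}K_X$ for all $X$; write $\|T\|^2=h(T,T)$. Assume that $x$ is a Tchebychev hypersurface, i.e. $\hat\nabla_XT=\alpha X$ for all $X$, where $\alpha=\frac1n\operatorname{div}T$, that $T$ does not vanish identically, and that $K_TT=\lambda T$ for some $\lambda\in C^\infty(M)$. Let $\widetilde M=\{p\in M: T(p)\ne0\}$, and for $p\in\widetilde M$ let $\mathfrak D(p)=\{v\in T_pM: h(v,T(p))=0\}$. Then one of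 the following two cases occurs. (i) $\widetilde M=M$, i.e. $T$ has no zeros; $\hat\nabla T=0$; and $K_T$ has exactly two distinct eigenvalues on $\mathfrak D$, which are constant: there are real numbers $\mu_1\neq\mu_2$ such that, at every $p\in M$, the set of eigenvalues of $K_T$ on $\mathfrak D(p)$ is $\{\mu_1,\mu_2\}$. (ii) There is a smooth function $\mu:\widetilde M\to\mathbb R$ such that $K_TV=\mu V$ for all $V\in\mathfrak D$, and on $\widetilde M$ $$\mu'=(\lambda-\mu)\alpha,\qquad n\|T\|^2=\lambda+(n-1)\mu,$$ where $\mu'=T(\mu)$ is the derivative of $\mu$ in the direction of $T$; moreover $\varepsilon\|T\|^2-\mu^2+\alpha^2$ is constant on $\widetilde M$. -/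

import Mathlib

open scoped Manifold ContDiff

noncomputable section

namespace Centroaffine

/-- `ℝⁿ`, the model space of the hypersurface. -/
abbrev Model (n : ℕ) : Type := EuclideanSpace ℝ (Fin n)

variable {n : ℕ} {M : Type*} [TopologicalSpace M] [ChartedSpace (Model n) M]
  [IsManifold (𝓡 n) ∞ M]

/-- A centroaffine hypersurface `x : Mⁿ → ℝⁿ⁺¹`: a smooth immersion whose position vector is at every
point transversal to the tangent space. -/
structure IsHypersurface (x : M → Model (n + 1)) : Prop where
  smooth : ContMDiff (𝓡 n) 𝓘(ℝ, Model (n + 1)) ∞ x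
  immersion : ∀ p, Function.Injective (mvfderiv (𝓡 n) x p)
  transversal : ∀ p, x p ∉ Set.range (mvfderiv (𝓡 n) x p)

/-- The map `T_pM × ℝ → ℝⁿ⁺¹`, `(v, t) ↦ x_*(v) + t (-ε x(p))`, expressing the splitting of `ℝⁿ⁺¹`
into the tangent space and the line of the centroaffine normal `-ε x`. It is invertible at every point
of a centroaffine hypersurface, if `ε ≠ 0`. -/
def splitting (x : M → Model (n + 1)) (ε : ℝ) (p : M) :
    TangentSpace (𝓡 n) p × ℝ →L[ℝ] Model (n + 1) :=
  (mvfderiv (𝓡 n) x p).coprod (ContinuousLinearMap.toSpanSingleton ℝ (-(ε • x p)))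

/-- The derivative `D_v x_*(Y)` at `p`, as a linear function of `v`, split into its tangential and
normal components: the pair `(∇_v Y, h(v, Y))` of the centroaffine Gauss formula
`D_v x_*(Y) = x_*(∇_v Y) + h(v, Y) (-ε x)`. -/
def gauss (x : M → Model (n + 1)) (ε : ℝ) (Y : Π p : M, TangentSpace (𝓡 n) p) (p : M) :
    TangentSpace (𝓡 n) p →L[ℝ] TangentSpace (𝓡 n) p × ℝ :=
  (splitting x ε p).inverse ∘L mvfderiv (𝓡 n) (fun q => mvfderiv (𝓡 n) x q (Y q)) p

/-- The induced centroaffine connection: `inducedConnection x ε Y p v = (∇_v Y)(p)`. -/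
def inducedConnection (x : M → Model (n + 1)) (ε : ℝ) (Y : Π p : M, TangentSpace (𝓡 n) p) (p : M) :
    TangentSpace (𝓡 n) p →L[ℝ] TangentSpace (𝓡 n) p :=
  ContinuousLinearMap.fst ℝ _ _ ∘L gauss x ε Y p

/-- The centroaffine metric `h_p(v, w)`: the normal component in the Gauss formula for `D_v x_*(W)`,
where `W` is a local vector field, smooth near `p`, with `W(p) = w`. (It does not depend on the choice
of `W`.) -/
def metric (x : M → Model (n + 1)) (ε : ℝ) (p : M) (v w : TangentSpace (𝓡 n) p) : ℝ :=
  (gauss x ε (FiberBundle.extend (Model n) w) p v).2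

/-- `h` is positive definite: `x` is locally strongly convex and the sign `ε` is the right one. -/
def IsPositive (x : M → Model (n + 1)) (ε : ℝ) : Prop :=
  ∀ (p : M) (v : TangentSpace (𝓡 n) p), v ≠ 0 → 0 < metric x ε p v v

/-- The vector field `Y` is differentiable at `p`. -/
def DiffAt (Y : Π p : M, TangentSpace (𝓡 n) p) (p : M) : Prop :=
  MDifferentiableAt (𝓡 n) ((𝓡 n).prod 𝓘(ℝ, Model n))
    (fun q => Bundle.TotalSpace.mk' (Model n) (E := TangentSpace (𝓡 n)) q (Y q)) p

/-- `D` (with `D Y p v = (D_v Y)(p)`) is a Levi-Civita connection of the metric `g`: a covariant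
derivative on `TM` that is torsion free and compatible with `g`. As always for covariant derivatives
in Mathlib, the laws concern vector fields that are differentiable at the point under consideration. -/
structure IsLeviCivita (g : Π p : M, TangentSpace (𝓡 n) p → TangentSpace (𝓡 n) p → ℝ)
    (D : (Π p : M, TangentSpace (𝓡 n) p) →
      Π p : M, TangentSpace (𝓡 n) p →L[ℝ] TangentSpace (𝓡 n) p) : Prop where
  covariant : IsCovariantDerivativeOn (Model n) D
  torsion_free : ∀ (p : M) (X Y : Π p : M, TangentSpace (𝓡 n) p),
    DiffAt X p → DiffAt Y p →
      D Y p (X p) - D X p (Y p) = VectorField.mlieBracket (𝓡 n) X Y p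
  compatible : ∀ (p : M) (Y Z : Π p : M, TangentSpace (𝓡 n) p) (v : TangentSpace (𝓡 n) p),
    DiffAt Y p → DiffAt Z p →
      mvfderiv (𝓡 n) (fun q => g q (Y q) (Z q)) p v = g p (D Y p v) (Z p) + g p (Y p) (D Z p v)

/-- The Levi-Civita connection `∇̂` of the centroaffine metric, `leviCivita x ε Y p v = (∇̂_v Y)(p)`:
the connection with the defining properties `IsLeviCivita`. By the fundamental theorem of Riemannian
geometry it exists if `h` is positive definite, and its value is unique on every vector field that
is differentiable at `p`. -/
def leviCivita (x : M → Model (n + 1)) (ε : ℝ) : (Π p : M, TangentSpace (𝓡 n) p) →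
    Π p : M, TangentSpace (𝓡 n) p →L[ℝ] TangentSpace (𝓡 n) p :=
  Classical.epsilon (IsLeviCivita (metric x ε))

/-- The difference tensor `K_v w = K(v, w) = ∇_v W - ∇̂_v W` at `p`, where `W` is a local vector field,
smooth near `p`, with `W(p) = w`. (It does not depend on the choice of `W`.) -/
def difference (x : M → Model (n + 1)) (ε : ℝ) (p : M) (v w : TangentSpace (𝓡 n) p) :
    TangentSpace (𝓡 n) p :=
  inducedConnection x ε (FiberBundle.extend (Model n) w) p v -
    leviCivita x ε (FiberBundle.extend (Model n) w) p v

/-- The Tchebychev form `T♯(v) = (1/n) Tr K_v`, the trace being computed in the standard basis of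
`T_pM = ℝⁿ`. -/
def tchebychevForm (x : M → Model (n + 1)) (ε : ℝ) (p : M) (v : TangentSpace (𝓡 n) p) : ℝ :=
  (1 / n : ℝ) * ∑ i : Fin n,
    EuclideanSpace.proj (𝕜 := ℝ) i (difference x ε p v (EuclideanSpace.single i (1 : ℝ)))

/-- The Tchebychev vector field `T`, given implicitly by `h(T, v) = T♯(v)` for all `v`. (There is
exactly one such vector at each point, if `h` is positive definite.) -/
def tchebychevField (x : M → Model (n + 1)) (ε : ℝ) (p : M) : TangentSpace (𝓡 n) p :=
  Classical.epsilon fun t : TangentSpace (𝓡 n) p => ∀ v, metric x ε p t v = tchebychevForm x ε p v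

/-- The Tchebychev operator `v ↦ ∇̂_v T`. -/
def tchebychevOperator (x : M → Model (n + 1)) (ε : ℝ) (p : M) :
    TangentSpace (𝓡 n) p →L[ℝ] TangentSpace (𝓡 n) p :=
  leviCivita x ε (tchebychevField x ε) p

/-- The function `(1/n) div T = (1/n) Tr (v ↦ ∇̂_v T)`. -/
def meanCurvature (x : M → Model (n + 1)) (ε : ℝ) (p : M) : ℝ :=
  (1 / n : ℝ) * LinearMap.trace ℝ (TangentSpace (𝓡 n) p) (tchebychevOperator x ε p : _ →ₗ[ℝ] _)

/-- The Tchebychev operator is `(1/n) (div T) id`. -/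
def IsTchebychev (x : M → Model (n + 1)) (ε : ℝ) : Prop :=
  ∀ (p : M) (v : TangentSpace (𝓡 n) p), tchebychevOperator x ε p v = meanCurvature x ε p • v

/-- `‖T‖²`, with respect to the centroaffine metric. -/
def normSqT (x : M → Model (n + 1)) (ε : ℝ) (p : M) : ℝ :=
  metric x ε p (tchebychevField x ε p) (tchebychevField x ε p)

/-- The `h`-orthogonal complement of `T` in `T_pM`; the distribution `𝔇` consists of these spaces at
the points where `T ≠ 0`. -/
def orthT (x : M → Model (n + 1)) (ε : ℝ) (p : M) : Set (TangentSpace (𝓡 n) p) :=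
  {v | metric x ε p v (tchebychevField x ε p) = 0}

end Centroaffine

end

/-! Write q = ‖T‖², L = K_T, a = T(α), and let a prime denote the derivative along T. Flatness of
the ambient connection gives the Gauss and Codazzi equations for K. Together with ∇̂T = α·id and K_T
T = λT they yield two facts. On 𝔇 the operator L satisfies L² − λL + (εq + a) = 0 (`K_T_mul_self`),
so it has at most two eigenvalues there. Along T its derivative is ∇̂_T L = dλ ⊗ T + α(λ − L)
(`covariant_T_K_T`), so formally each eigenvalue μ on 𝔇 obeys μ' = α(λ − μ).

If both roots occur, their sum is λ, and adding the two equations gives λ' = αλ. To avoid questions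
of multiplicity and smoothness of eigenvalues, this is derived from the traces of L, L², L³:
`discriminant_mul` says that N·(λ' − αλ) = 0, where N is `spread`, a multiple of the variance of the
eigenvalues on 𝔇. The trace of L alone gives 3nαq = λ' + nαλ. Where N ≠ 0 and T ≠ 0, these two
relations force α = 0, and then q, λ and N are locally constant. Where N = 0 and T ≠ 0, N has a
local minimum, because a variance is nonnegative. Hence dN = 0 wherever T ≠ 0.

The pair (T, α) satisfies a homogeneous linear first order system, so it cannot vanish at a point
without vanishing identically. Therefore the points with T ≠ 0 are dense, and N is constant on the
connected manifold. If N ≠ 0, then α vanishes everywhere, T has no zeros, and the two eigenvalues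
are the roots of a quadratic with constant coefficients: case (i). If N = 0, then L is a scalar μ on
𝔇 and εq + a = μ(λ − μ), which makes the derivative of εq − μ² + α² vanish: case (ii). -/

open scoped Topology

noncomputable section

namespace Centroaffine

/-! ### Calculus in normed spaces: mixed derivatives, Gronwall uniqueness, derivatives of traces of
powers. -/

section Calculus

variable {E F V W : Type*} [NormedAddCommGroup E] [NormedSpace ℝ E]
  [NormedAddCommGroup F] [NormedSpace ℝ F] [NormedAddCommGroup V] [NormedSpace ℝ V]
  [NormedAddCommGroup W] [NormedSpace ℝ W]

theorem fderiv_fderiv_apply_comm {φ : E → F} {y : E} (hφ : ContDiffAt ℝ 2 φ y) (u v : E) :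
    fderiv ℝ (fun z => fderiv ℝ φ z u) y v = fderiv ℝ (fun z => fderiv ℝ φ z v) y u := by
  have hd : DifferentiableAt ℝ (fderiv ℝ φ) y :=
    (hφ.fderiv_right (m := 1) (by norm_num)).differentiableAt (by norm_num)
  have key : ∀ w, HasFDerivAt (fun z => fderiv ℝ φ z w)
      ((ContinuousLinearMap.apply ℝ F w).comp (fderiv ℝ (fderiv ℝ φ) y)) y := fun w =>
    (ContinuousLinearMap.apply ℝ F w).hasFDerivAt.comp y hd.hasFDerivAt
  rw [(key u).fderiv, (key v).fderiv]
  have := hφ.isSymmSndFDerivAt (by simp) v u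
  simpa using this

theorem hasFDerivAt_clm_apply₂ {A : E → V →L[ℝ] W →L[ℝ] F} {a : E → V} {b : E → W} {y : E}
    (hA : DifferentiableAt ℝ A y) (ha : DifferentiableAt ℝ a y) (hb : DifferentiableAt ℝ b y) :
    DifferentiableAt ℝ (fun z => A z (a z) (b z)) y :=
  (hA.clm_apply ha).clm_apply hb

theorem fderiv_clm_apply₂ {A : E → V →L[ℝ] W →L[ℝ] F} {a : E → V} {b : E → W} {y : E}
    (hA : DifferentiableAt ℝ A y) (ha : DifferentiableAt ℝ a y) (hb : DifferentiableAt ℝ b y)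
    (u : E) :
    fderiv ℝ (fun z => A z (a z) (b z)) y u =
      fderiv ℝ A y u (a y) (b y) + A y (fderiv ℝ a y u) (b y) + A y (a y) (fderiv ℝ b y u) := by
  rw [fderiv_clm_apply (hA.clm_apply ha) hb, fderiv_clm_apply hA ha]
  simp
  abel

/-- Gronwall's inequality along the segment from the centre of the ball. It serves as unique
continuation for the linear system satisfied by (T, α). -/
theorem eqOn_zero_of_norm_fderiv_le {f : E → F} {y₀ : E} {r C : ℝ}
    (hf : ∀ y ∈ Metric.ball y₀ r, DifferentiableAt ℝ f y)
    (hC : ∀ y ∈ Metric.ball y₀ r, ‖fderiv ℝ f y‖ ≤ C * ‖f y‖) (h0 : f y₀ = 0) :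
    ∀ y ∈ Metric.ball y₀ r, f y = 0 := by
  intro y hy
  set γ : ℝ → E := fun t => y₀ + t • (y - y₀) with hγ
  have hmem : ∀ t ∈ Set.Icc (0 : ℝ) 1, γ t ∈ Metric.ball y₀ r := by
    intro t ht
    rw [Metric.mem_ball, dist_eq_norm] at hy ⊢
    have : γ t - y₀ = t • (y - y₀) := by simp [hγ]
    rw [this, norm_smul, Real.norm_eq_abs, abs_of_nonneg ht.1]
    nlinarith [norm_nonneg (y - y₀), ht.2]
  have hder : ∀ t ∈ Set.Icc (0 : ℝ) 1,
      HasDerivAt (fun s => f (γ s)) (fderiv ℝ f (γ t) (y - y₀)) t := by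
    intro t ht
    have h1 : HasDerivAt γ (y - y₀) t :=
      (((hasDerivAt_id t).smul_const (y - y₀)).const_add y₀).congr_deriv (one_smul ℝ _)
    exact (hf _ (hmem t ht)).hasFDerivAt.comp_hasDerivAt t h1
  have key := norm_le_gronwallBound_of_norm_deriv_right_le (f := fun s => f (γ s))
    (f' := fun t => fderiv ℝ f (γ t) (y - y₀)) (δ := 0) (K := C * ‖y - y₀‖) (ε := 0) (a := 0)
    (b := 1) (fun t ht => (hder t ht).continuousAt.continuousWithinAt)
    (fun t ht => (hder t (Set.Ico_subset_Icc_self ht)).hasDerivWithinAt) (by simp [hγ, h0])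
    (by
      intro t ht
      have h1 := hC _ (hmem t (Set.Ico_subset_Icc_self ht))
      have h2 := (fderiv ℝ f (γ t)).le_opNorm (y - y₀)
      have := mul_le_mul_of_nonneg_right h1 (norm_nonneg (y - y₀))
      simp only [add_zero]
      nlinarith) 1 (by simp)
  have h1 : γ 1 = y := by simp [hγ]
  simpa [h1, gronwallBound_ε0_δ0] using key

variable {R : Type*} [NormedRing R] [NormedAlgebra ℝ R]

/-- Cyclicity of `τ` merges the terms of the product rule, although `A y` need not commute with its
derivative. -/
theorem fderiv_trace_sq (τ : R →L[ℝ] ℝ) (hτ : ∀ a b, τ (a * b) = τ (b * a)) {A : E → R} {y : E}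
    (hA : DifferentiableAt ℝ A y) (u : E) :
    fderiv ℝ (fun z => τ (A z * A z)) y u = 2 * τ (A y * fderiv ℝ A y u) := by
  have h2 : HasFDerivAt (fun z => τ (A z * A z)) _ y :=
    τ.hasFDerivAt.comp y (hA.hasFDerivAt.mul' hA.hasFDerivAt)
  rw [h2.fderiv]
  have := hτ (fderiv ℝ A y u) (A y)
  simp [this]
  ring

theorem fderiv_trace_cube (τ : R →L[ℝ] ℝ) (hτ : ∀ a b, τ (a * b) = τ (b * a)) {A : E → R} {y : E}
    (hA : DifferentiableAt ℝ A y) (u : E) :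
    fderiv ℝ (fun z => τ (A z * (A z * A z))) y u = 3 * τ (A y * (A y * fderiv ℝ A y u)) := by
  have h2 : HasFDerivAt (fun z => τ (A z * (A z * A z))) _ y :=
    τ.hasFDerivAt.comp y (hA.hasFDerivAt.mul' (hA.hasFDerivAt.mul' hA.hasFDerivAt))
  rw [h2.fderiv]
  have e1 := hτ (fderiv ℝ A y u) (A y * A y)
  have e2 := hτ (fderiv ℝ A y u * A y) (A y)
  simp only [mul_assoc] at e1 e2
  simp [← e2, e1]
  ring

end Calculus

/-! ### The trace form and positivity of the trace of the square of a self-adjoint operator. -/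

section Trace

variable {E : Type*} [NormedAddCommGroup E] [NormedSpace ℝ E] [FiniteDimensional ℝ E]

/-- The trace of continuous endomorphisms, as a continuous linear form. -/
def traceL (E : Type*) [NormedAddCommGroup E] [NormedSpace ℝ E] [FiniteDimensional ℝ E] :
    (E →L[ℝ] E) →L[ℝ] ℝ :=
  LinearMap.toContinuousLinearMap
    ((LinearMap.trace ℝ E).comp (ContinuousLinearMap.coeLM ℝ : (E →L[ℝ] E) →ₗ[ℝ] E →ₗ[ℝ] E))

theorem traceL_apply (A : E →L[ℝ] E) : traceL E A = LinearMap.trace ℝ E (A : E →ₗ[ℝ] E) := rfl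

theorem traceL_mul_comm (A B : E →L[ℝ] E) : traceL E (A * B) = traceL E (B * A) :=
  LinearMap.trace_mul_comm ℝ (A : E →ₗ[ℝ] E) (B : E →ₗ[ℝ] E)

theorem traceL_one : traceL E 1 = Module.finrank ℝ E := LinearMap.trace_one ℝ E

theorem traceL_smulRight (φ : E →L[ℝ] ℝ) (t : E) : traceL E (φ.smulRight t) = φ t := by
  have : ((φ.smulRight t : E →L[ℝ] E) : E →ₗ[ℝ] E) = (φ : E →ₗ[ℝ] ℝ).smulRight t := rfl
  rw [traceL_apply, this, LinearMap.trace_smulRight]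
  rfl

/-- The trace of the square of a self-adjoint endomorphism is nonnegative, and it vanishes only if
the endomorphism does. -/
theorem traceL_mul_self_of_selfAdjoint (g : E →L[ℝ] E →L[ℝ] ℝ) (hsymm : ∀ v w, g v w = g w v)
    (hpos : ∀ v, v ≠ 0 → 0 < g v v) (A : E →L[ℝ] E) (hA : ∀ v w, g (A v) w = g v (A w)) :
    0 ≤ traceL E (A * A) ∧ (traceL E (A * A) = 0 → A = 0) := by
  let B : LinearMap.BilinForm ℝ E := LinearMap.mk₂ ℝ (fun v w => g v w)
    (by simp) (by simp) (by simp) (by simp)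
  have hB : ∀ v w, B v w = g v w := fun v w => rfl
  obtain ⟨b, hb⟩ := LinearMap.BilinForm.exists_orthogonal_basis (B := B)
    ⟨fun v w => by simp [hB, hsymm v w]⟩
  have hbi : ∀ i, 0 < g (b i) (b i) := fun i => hpos _ (b.ne_zero i)
  have hrepr : ∀ v i, b.repr v i = g v (b i) / g (b i) (b i) := by
    intro v i
    rw [eq_div_iff (hbi i).ne']
    conv_rhs => rw [← b.sum_repr v]
    rw [map_sum, sum_apply, Finset.sum_eq_single i]
    · simp
    · intro j _ hj
      have : g (b j) (b i) = 0 := hb hj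
      simp [this]
    · simp
  -- In a `g`-orthogonal basis the i-th diagonal entry of A² is g(A²bᵢ, bᵢ)/g(bᵢ, bᵢ), and
  -- self-adjointness moves one factor A across.
  have htr : traceL E (A * A) = ∑ i, g (A (b i)) (A (b i)) / g (b i) (b i) := by
    rw [traceL_apply, LinearMap.trace_eq_matrix_trace ℝ b, Matrix.trace]
    refine Finset.sum_congr rfl fun i _ => ?_
    rw [Matrix.diag_apply, LinearMap.toMatrix_apply, hrepr]
    congr 1
    exact hA _ _
  have hnn : ∀ v, 0 ≤ g v v := fun v => by
    rcases eq_or_ne v 0 with rfl | hv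
    · simp
    · exact (hpos v hv).le
  refine ⟨htr ▸ Finset.sum_nonneg fun i _ => div_nonneg (hnn _) (hbi i).le, fun h0 => ?_⟩
  rw [htr, Finset.sum_eq_zero_iff_of_nonneg
    (fun i _ => div_nonneg (hnn _) (hbi i).le)] at h0
  have hz : ∀ i, A (b i) = 0 := by
    intro i
    by_contra hne
    have := h0 i (Finset.mem_univ i)
    rw [div_eq_zero_iff] at this
    rcases this with h | h
    · exact (hpos _ hne).ne' h
    · exact (hbi i).ne' h
  have : (A : E →ₗ[ℝ] E) = 0 := b.ext fun i => by simpa using hz i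
  ext v
  exact congrArg (fun f : E →ₗ[ℝ] E => f v) this

end Trace

end Centroaffine
end

/-! ### Gauss and Codazzi equations for the difference tensor, in coordinates. -/

noncomputable section

namespace Centroaffine

variable {E : Type*} [NormedAddCommGroup E] [NormedSpace ℝ E]

/-- The local invariants of a centroaffine hypersurface in coordinates: the metric `g`, the
Christoffel form `G` of its Levi-Civita connection and the difference tensor `K`. -/
structure LocalGeometry (ε : ℝ) (Ω : Set E) (g : E → E →L[ℝ] E →L[ℝ] ℝ)
    (G K : E → E →L[ℝ] E →L[ℝ] E) : Prop where
  isOpen : IsOpen Ω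
  g_smooth : ContDiffOn ℝ ∞ g Ω
  G_smooth : ContDiffOn ℝ ∞ G Ω
  K_smooth : ContDiffOn ℝ ∞ K Ω
  g_symm : ∀ y ∈ Ω, ∀ v w, g y v w = g y w v
  g_pos : ∀ y ∈ Ω, ∀ v, v ≠ 0 → 0 < g y v v
  G_symm : ∀ y ∈ Ω, ∀ v w, G y v w = G y w v
  K_symm : ∀ y ∈ Ω, ∀ v w, K y v w = K y w v
  K_self : ∀ y ∈ Ω, ∀ u v w, g y (K y u v) w = g y v (K y u w)
  compat : ∀ y ∈ Ω, ∀ u v w, fderiv ℝ g y u v w = g y (G y u v) w + g y v (G y u w)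
  -- The curvature of ∇ = ∇̂ + K, whose Christoffel form is G + K, equals ε(g(v,w)u − g(u,w)v); the
  -- parts coming from ∇̂ and from K are separated only in `codazzi` and `gauss_skew`.
  gauss : ∀ y ∈ Ω, ∀ u v w,
    fderiv ℝ G y u v w + fderiv ℝ K y u v w + G y u (G y v w) + G y u (K y v w) + K y u (G y v w)
        + K y u (K y v w) - (ε * g y v w) • u =
      fderiv ℝ G y v u w + fderiv ℝ K y v u w + G y v (G y u w) + G y v (K y u w) + K y v (G y u w)
        + K y v (K y u w) - (ε * g y u w) • v

namespace LocalGeometry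

variable {ε : ℝ} {Ω : Set E} {g : E → E →L[ℝ] E →L[ℝ] ℝ} {G K : E → E →L[ℝ] E →L[ℝ] E}
  (h : LocalGeometry ε Ω g G K) {y : E} (hy : y ∈ Ω)

include h hy

theorem eq_of_forall {a b : E} (hab : ∀ w, g y a w = g y b w) : a = b := by
  by_contra hne
  have := h.g_pos y hy (a - b) (sub_ne_zero.2 hne)
  have h2 := hab (a - b)
  simp only [map_sub, _root_.sub_apply] at this h2
  linarith

theorem mem_nhds : Ω ∈ 𝓝 y := h.isOpen.mem_nhds hy

theorem differentiableAt_g : DifferentiableAt ℝ g y :=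
  (h.g_smooth.contDiffAt (h.mem_nhds hy)).differentiableAt (by simp)

theorem differentiableAt_G : DifferentiableAt ℝ G y :=
  (h.G_smooth.contDiffAt (h.mem_nhds hy)).differentiableAt (by simp)

theorem differentiableAt_K : DifferentiableAt ℝ K y :=
  (h.K_smooth.contDiffAt (h.mem_nhds hy)).differentiableAt (by simp)

/-- Product rule for the metric in terms of its Levi-Civita connection. -/
theorem fderiv_metric {a b : E → E} (ha : DifferentiableAt ℝ a y) (hb : DifferentiableAt ℝ b y)
    (u : E) :
    fderiv ℝ (fun z => g z (a z) (b z)) y u =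
      g y (fderiv ℝ a y u + G y u (a y)) (b y) + g y (a y) (fderiv ℝ b y u + G y u (b y)) := by
  rw [fderiv_clm_apply₂ (h.differentiableAt_g hy) ha hb, h.compat y hy]
  simp only [map_add, _root_.add_apply]
  ring

/-- Differentiating metric compatibility once more and using the symmetry of the second derivatives
of g(v, w) shows that the curvature of ∇̂ is skew for g. -/
theorem curvature_skew (u' u v w : E) :
    g y (fderiv ℝ G y u' u v - fderiv ℝ G y u u' v + G y u' (G y u v) - G y u (G y u' v)) w +
      g y v (fderiv ℝ G y u' u w - fderiv ℝ G y u u' w + G y u' (G y u w) - G y u (G y u' w)) = 0 := by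
  have hφ : ContDiffAt ℝ 2 (fun z => g z v w) y :=
    (((h.g_smooth.contDiffAt (h.mem_nhds hy)).of_le (by norm_cast)).clm_apply
      contDiffAt_const).clm_apply contDiffAt_const
  have h1 : ∀ u, (fun z => fderiv ℝ (fun z => g z v w) z u) =ᶠ[𝓝 y]
      fun z => g z (G z u v) w + g z v (G z u w) := by
    intro u
    filter_upwards [h.mem_nhds hy] with z hz
    rw [h.fderiv_metric hz (differentiableAt_const v) (differentiableAt_const w)]
    simp
  have hGd : ∀ u v, DifferentiableAt ℝ (fun z => G z u v) y := fun u v =>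
    hasFDerivAt_clm_apply₂ (h.differentiableAt_G hy) (differentiableAt_const u)
      (differentiableAt_const v)
  have hG : ∀ u' u v, fderiv ℝ (fun z => G z u v) y u' = fderiv ℝ G y u' u v := by
    intro u' u v
    rw [fderiv_clm_apply₂ (h.differentiableAt_G hy) (differentiableAt_const u)
      (differentiableAt_const v)]
    simp
  have h2 : ∀ u u', fderiv ℝ (fun z => fderiv ℝ (fun z => g z v w) z u) y u' =
      g y (fderiv ℝ G y u' u v + G y u' (G y u v)) w + g y (G y u v) (G y u' w) +
      (g y (G y u' v) (G y u w) + g y v (fderiv ℝ G y u' u w + G y u' (G y u w))) := by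
    intro u u'
    rw [(h1 u).fderiv_eq, fderiv_fun_add
      (hasFDerivAt_clm_apply₂ (h.differentiableAt_g hy) (hGd u v) (differentiableAt_const w))
      (hasFDerivAt_clm_apply₂ (h.differentiableAt_g hy) (differentiableAt_const v) (hGd u w)),
      _root_.add_apply, h.fderiv_metric hy (hGd u v) (differentiableAt_const w),
      h.fderiv_metric hy (differentiableAt_const v) (hGd u w), hG, hG]
    simp
  have h3 := fderiv_fderiv_apply_comm hφ u u'
  rw [h2, h2] at h3
  simp only [map_add, map_sub, _root_.add_apply, _root_.sub_apply] at h3 ⊢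
  linear_combination h3

theorem fderiv_K_symm (u v w : E) : fderiv ℝ K y u v w = fderiv ℝ K y u w v := by
  have hK : ∀ v w, fderiv ℝ (fun z => K z v w) y u = fderiv ℝ K y u v w := by
    intro v w
    rw [fderiv_clm_apply₂ (h.differentiableAt_K hy) (differentiableAt_const v)
      (differentiableAt_const w)]
    simp
  rw [← hK, ← hK]
  have : (fun z => K z v w) =ᶠ[𝓝 y] fun z => K z w v := by
    filter_upwards [h.mem_nhds hy] with z hz using h.K_symm z hz v w
  rw [this.fderiv_eq]

/-- The covariant derivative of the cubic form is symmetric in its last two arguments. -/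
theorem covariant_K_symm (u v w z : E) :
    g y (fderiv ℝ K y u v w + G y u (K y v w) - K y v (G y u w)) z =
      g y (fderiv ℝ K y u v z + G y u (K y v z) - K y v (G y u z)) w := by
  have hKd : ∀ v w, DifferentiableAt ℝ (fun z => K z v w) y := fun u v =>
    hasFDerivAt_clm_apply₂ (h.differentiableAt_K hy) (differentiableAt_const u)
      (differentiableAt_const v)
  have hK : ∀ v w, fderiv ℝ (fun z => K z v w) y u = fderiv ℝ K y u v w := by
    intro v w
    rw [fderiv_clm_apply₂ (h.differentiableAt_K hy) (differentiableAt_const v)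
      (differentiableAt_const w)]
    simp
  have h1 : (fun x => g x (K x v w) z) =ᶠ[𝓝 y] fun x => g x (K x v z) w := by
    filter_upwards [h.mem_nhds hy] with x hx
    rw [h.K_self x hx, h.g_symm x hx]
  have h2 := congrArg (fun f : E →L[ℝ] ℝ => f u) h1.fderiv_eq
  simp only [h.fderiv_metric hy (hKd v w) (differentiableAt_const z),
    h.fderiv_metric hy (hKd v z) (differentiableAt_const w), hK] at h2
  have h3 := h.K_self y hy v (G y u w) z
  have h4 := h.K_self y hy v (G y u z) w
  have h5 := h.g_symm y hy (K y v w) (G y u z)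
  have h6 := h.g_symm y hy (K y v z) (G y u w)
  simp only [map_add, map_sub, _root_.add_apply,
    _root_.sub_apply, fderiv_fun_const, Pi.zero_apply,
    _root_.zero_apply, zero_add] at h2 ⊢
  linear_combination h2 - h3 + h4 - h5 + h6

/-- The symmetric part of the Gauss equation: the Codazzi equation for `K`. -/
theorem codazzi (u v w : E) :
    fderiv ℝ K y u v w + G y u (K y v w) - K y v (G y u w) =
      fderiv ℝ K y v u w + G y v (K y u w) - K y u (G y v w) := by
  refine h.eq_of_forall hy fun z => ?_
  -- Add the Gauss equation paired with z to the one with w and z interchanged. The curvature of G,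
  -- the commutator of K_u with K_v and the ε terms are skew in w, z and cancel; the derivative of K
  -- is symmetric in w, z and doubles.
  have e1 := congrArg (fun t => g y t z) (h.gauss y hy u v w)
  have e2 := congrArg (fun t => g y t w) (h.gauss y hy u v z)
  have s1 := h.covariant_K_symm hy u v w z
  have s2 := h.covariant_K_symm hy v u w z
  have c := h.curvature_skew hy u v w z
  have k1 := h.K_self y hy u (K y v w) z
  have k2 := h.K_self y hy v (K y u z) w
  have k3 := h.K_self y hy v (K y u w) z
  have k4 := h.K_self y hy u (K y v z) w
  have k5 := h.g_symm y hy (K y v w) (K y u z)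
  have k6 := h.g_symm y hy (K y u w) (K y v z)
  rw [h.g_symm y hy w] at c
  simp only [map_add, map_sub, map_smul, smul_eq_mul, _root_.add_apply,
    _root_.sub_apply, _root_.smul_apply] at e1 e2 s1 s2 c ⊢
  linear_combination (e1 + e2 - c + s1 - s2 - k1 + k2 + k3 - k4 - k5 + k6) / 2

/-- The skew-symmetric part of the Gauss equation. -/
theorem gauss_skew (u v w : E) :
    fderiv ℝ G y u v w - fderiv ℝ G y v u w + G y u (G y v w) - G y v (G y u w) =
      (ε * g y v w) • u - (ε * g y u w) • v - K y u (K y v w) + K y v (K y u w) := by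
  linear_combination (norm := module) h.gauss y hy u v w - h.codazzi hy u v w

end LocalGeometry
end Centroaffine
end

/-! ### Local consequences of ∇̂T = α·id and K_T T = λT: the operator K_T, its powers and its
derivative along T. -/

noncomputable section

namespace Centroaffine

variable {E : Type*} [NormedAddCommGroup E] [NormedSpace ℝ E] [FiniteDimensional ℝ E]

/-- The local invariants of a Tchebychev hypersurface with `K_T T = lam T`, in coordinates. -/
structure LocalTchebychev (ε : ℝ) (Ω : Set E) (g : E → E →L[ℝ] E →L[ℝ] ℝ)
    (G K : E → E →L[ℝ] E →L[ℝ] E) (T : E → E) (α lam : E → ℝ) : Prop extends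
    LocalGeometry ε Ω g G K where
  T_smooth : ContDiffOn ℝ ∞ T Ω
  α_smooth : ContDiffOn ℝ ∞ α Ω
  lam_smooth : ContDiffOn ℝ ∞ lam Ω
  trace_K : ∀ y ∈ Ω, ∀ v, Module.finrank ℝ E * g y (T y) v = traceL E (K y v)
  fderiv_T : ∀ y ∈ Ω, ∀ v, fderiv ℝ T y v = α y • v - G y v (T y)
  eigen : ∀ y ∈ Ω, K y (T y) (T y) = lam y • T y

namespace LocalTchebychev

variable {ε : ℝ} {Ω : Set E} {g : E → E →L[ℝ] E →L[ℝ] ℝ} {G K : E → E →L[ℝ] E →L[ℝ] E}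
  {T : E → E} {α lam : E → ℝ} (h : LocalTchebychev ε Ω g G K T α lam) {y : E} (hy : y ∈ Ω)

include h hy

theorem differentiableAt_T : DifferentiableAt ℝ T y :=
  (h.T_smooth.contDiffAt (h.mem_nhds hy)).differentiableAt (by simp)

theorem differentiableAt_α : DifferentiableAt ℝ α y :=
  (h.α_smooth.contDiffAt (h.mem_nhds hy)).differentiableAt (by simp)

theorem differentiableAt_lam : DifferentiableAt ℝ lam y :=
  (h.lam_smooth.contDiffAt (h.mem_nhds hy)).differentiableAt (by simp)

theorem fderiv_normSq (u : E) :
    fderiv ℝ (fun z => g z (T z) (T z)) y u = 2 * α y * g y (T y) u := by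
  rw [h.fderiv_metric hy (h.differentiableAt_T hy) (h.differentiableAt_T hy), h.fderiv_T y hy]
  simp only [sub_add_cancel, map_smul, _root_.smul_apply, smul_eq_mul]
  rw [h.g_symm y hy u]
  ring

/-- `R(u, v) T = dα(u) v - dα(v) u`. -/
theorem curvature_T (u v : E) :
    fderiv ℝ G y u v (T y) - fderiv ℝ G y v u (T y) + G y u (G y v (T y)) - G y v (G y u (T y)) =
      fderiv ℝ α y u • v - fderiv ℝ α y v • u := by
  have hT2 : ContDiffAt ℝ 2 T y :=
    (h.T_smooth.contDiffAt (h.mem_nhds hy)).of_le (by norm_cast)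
  have h1 : ∀ v, (fun z => fderiv ℝ T z v) =ᶠ[𝓝 y] fun z => α z • v - G z v (T z) := by
    intro v
    filter_upwards [h.mem_nhds hy] with z hz using h.fderiv_T z hz v
  have h2 : ∀ u v, fderiv ℝ (fun z => fderiv ℝ T z v) y u = fderiv ℝ α y u • v -
      (fderiv ℝ G y u v (T y) + G y v (α y • u - G y u (T y))) := by
    intro u v
    rw [(h1 v).fderiv_eq, fderiv_fun_sub ((h.differentiableAt_α hy).smul_const v)
      (hasFDerivAt_clm_apply₂ (h.differentiableAt_G hy) (differentiableAt_const v)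
        (h.differentiableAt_T hy)), _root_.sub_apply,
      fderiv_clm_apply₂ (h.differentiableAt_G hy) (differentiableAt_const v)
        (h.differentiableAt_T hy), fderiv_smul_const (h.differentiableAt_α hy), h.fderiv_T y hy]
    simp
  have h3 := fderiv_fderiv_apply_comm hT2 u v
  rw [h2, h2] at h3
  simp only [map_sub, map_smul] at h3
  have h4 := h.G_symm y hy u v
  linear_combination (norm := module) h3 + α y • h4

/-- Two expressions for the curvature R̂(u, v)T are equated: one from ∇̂T = α·id, the other from the
Gauss equation. -/
theorem gauss_T (u v : E) :
    fderiv ℝ α y u • v - fderiv ℝ α y v • u =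
      (ε * g y v (T y)) • u - (ε * g y u (T y)) • v - K y u (K y v (T y)) + K y v (K y u (T y)) := by
  rw [← h.curvature_T hy, h.gauss_skew hy]

theorem fderiv_K_T (u v : E) : fderiv ℝ (fun z => K z (T z)) y u v =
    fderiv ℝ K y u (T y) v + K y (α y • u - G y u (T y)) v := by
  rw [fderiv_clm_apply (h.differentiableAt_K hy) (h.differentiableAt_T hy), ← h.fderiv_T y hy]
  simp [add_comm]

/-- `K_T` is a Codazzi tensor. -/
theorem codazzi_K_T (u v : E) :
    fderiv ℝ (fun z => K z (T z)) y u v + G y u (K y (T y) v) - K y (T y) (G y u v) =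
      fderiv ℝ (fun z => K z (T z)) y v u + G y v (K y (T y) u) - K y (T y) (G y v u) := by
  have hc := h.codazzi hy u v (T y)
  rw [h.fderiv_K_T hy, h.fderiv_K_T hy, h.fderiv_K_symm hy _ (T y) v, h.fderiv_K_symm hy _ (T y) u,
    h.G_symm y hy v u, h.K_symm y hy (T y) v, h.K_symm y hy (T y) u,
    h.K_symm y hy (α y • u - _) v, h.K_symm y hy (α y • v - _) u]
  -- Since ∇̂_u T = αu, differentiating T inside K_T contributes αK_u v, which is symmetric in u and
  -- v; the rest is the Codazzi equation for K.
  have hk := h.K_symm y hy u v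
  simp only [map_sub, map_smul]
  linear_combination (norm := module) hc - α y • hk

theorem covariant_K_T_T (u : E) :
    fderiv ℝ (fun z => K z (T z)) y u (T y) + G y u (K y (T y) (T y)) - K y (T y) (G y u (T y)) =
      fderiv ℝ lam y u • T y + α y • (lam y • u - K y (T y) u) := by
  have h1 : (fun z => K z (T z) (T z)) =ᶠ[𝓝 y] fun z => lam z • T z := by
    filter_upwards [h.mem_nhds hy] with z hz using h.eigen z hz
  have h2 := congrArg (fun f : E →L[ℝ] E => f u) h1.fderiv_eq
  rw [fderiv_clm_apply ((h.differentiableAt_K hy).clm_apply (h.differentiableAt_T hy))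
    (h.differentiableAt_T hy), fderiv_fun_smul (h.differentiableAt_lam hy)
    (h.differentiableAt_T hy)] at h2
  simp only [_root_.add_apply, ContinuousLinearMap.comp_apply, ContinuousLinearMap.flip_apply,
    _root_.smul_apply, ContinuousLinearMap.smulRight_apply, h.fderiv_T y hy, map_sub, map_smul] at h2
  rw [h.eigen y hy, map_smul]
  linear_combination (norm := module) h2

/-- Differentiating K_T T = λT controls (∇̂_u K_T)T, and the Codazzi property exchanges u with T.
This is the evolution law of K_T along T behind μ' = α(λ − μ). -/
theorem covariant_T_K_T (u : E) :
    fderiv ℝ (fun z => K z (T z)) y (T y) u + G y (T y) (K y (T y) u) - K y (T y) (G y (T y) u) =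
      fderiv ℝ lam y u • T y + α y • (lam y • u - K y (T y) u) := by
  rw [← h.covariant_K_T_T hy, h.codazzi_K_T hy]

/-- The gradient of λ is parallel to T: both ∇̂_T K_T and α(λ − K_T) are self-adjoint, so by
`covariant_T_K_T` dλ ⊗ T is self-adjoint too. -/
theorem fderiv_lam (u : E) :
    fderiv ℝ lam y u * g y (T y) (T y) = fderiv ℝ lam y (T y) * g y (T y) u := by
  have key : ∀ v w, g y (fderiv ℝ lam y v • T y + α y • (lam y • v - K y (T y) v)) w =
      g y (fderiv ℝ lam y w • T y + α y • (lam y • w - K y (T y) w)) v := by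
    intro v w
    rw [← h.covariant_T_K_T hy, ← h.covariant_T_K_T hy, h.fderiv_K_T hy, h.fderiv_K_T hy]
    have h1 := h.covariant_K_symm hy (T y) (T y) v w
    have h2 := h.K_self y hy (α y • T y - G y (T y) (T y)) v w
    have h3 := h.g_symm y hy v (K y (α y • T y - G y (T y) (T y)) w)
    simp only [map_add, map_sub, _root_.add_apply, _root_.sub_apply] at h1 h2 h3 ⊢
    linear_combination h1 + h2 + h3
  have h1 := key u (T y)
  have h2 := h.K_self y hy (T y) u (T y)
  have h3 := h.g_symm y hy u (T y)
  have h4 := h.g_symm y hy (K y (T y) (T y)) u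
  simp only [map_add, map_sub, map_smul, _root_.add_apply, _root_.sub_apply, _root_.smul_apply,
    smul_eq_mul] at h1
  linear_combination h1 + α y * h2 - α y * h4 - lam y * α y * h3

/-- The gradient of α is parallel to T, because R̂(u, T)T is orthogonal to T: the terms of `gauss_T`
with v = T cancel when paired with T. -/
theorem fderiv_α (u : E) :
    fderiv ℝ α y u * g y (T y) (T y) = fderiv ℝ α y (T y) * g y (T y) u := by
  have h1 := congrArg (fun t => g y t (T y)) (h.gauss_T hy u (T y))
  have h2 := h.K_self y hy u (K y (T y) (T y)) (T y)
  have h3 := h.K_self y hy (T y) (K y u (T y)) (T y)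
  have h4 := h.g_symm y hy u (T y)
  have h5 := h.g_symm y hy (K y u (T y)) (K y (T y) (T y))
  simp only [map_add, map_sub, map_smul, _root_.add_apply, _root_.sub_apply, _root_.smul_apply,
    smul_eq_mul] at h1
  linear_combination h1 + (fderiv ℝ α y (T y)) * h4 - h2 + h3 + h5

/-- `L² - λ L + c` vanishes on the orthogonal complement of `T`, where `L = K_T`. -/
theorem K_T_mul_self : K y (T y) * K y (T y) =
    lam y • K y (T y) - (ε * g y (T y) (T y) + fderiv ℝ α y (T y)) • (1 : E →L[ℝ] E) +
      (fderiv ℝ α y + ε • g y (T y)).smulRight (T y) := by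
  ext u
  -- Setting v = T in `gauss_T` and using K_u T = K_T u turns the quadratic terms in K into λK_T u
  -- and K_T² u.
  have h1 := h.gauss_T hy u (T y)
  have h2 := h.K_symm y hy u (T y)
  have h3 := h.g_symm y hy u (T y)
  rw [h.eigen y hy, map_smul, h2, h3] at h1
  simp only [mul_apply_eq_comp, _root_.add_apply, _root_.sub_apply, _root_.smul_apply,
    one_apply_eq_self, ContinuousLinearMap.smulRight_apply, smul_eq_mul]
  linear_combination (norm := module) -h1

theorem trace_K_T :
    traceL E (K y (T y)) = Module.finrank ℝ E * g y (T y) (T y) := (h.trace_K y hy (T y)).symm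

theorem trace_K_T_sq : traceL E (K y (T y) * K y (T y)) =
    lam y * (Module.finrank ℝ E * g y (T y) (T y)) -
      (Module.finrank ℝ E - 1) * (ε * g y (T y) (T y) + fderiv ℝ α y (T y)) := by
  rw [h.K_T_mul_self hy, map_add, map_sub, map_smul, map_smul, h.trace_K_T hy, traceL_one,
    traceL_smulRight]
  simp only [_root_.add_apply, _root_.smul_apply, smul_eq_mul]
  ring

theorem K_T_mul_smulRight (φ : E →L[ℝ] ℝ) :
    K y (T y) * φ.smulRight (T y) = lam y • φ.smulRight (T y) := by
  ext u
  simp [mul_apply_eq_comp, h.eigen y hy, smul_comm (lam y)]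

theorem trace_K_T_cube : traceL E (K y (T y) * (K y (T y) * K y (T y))) =
    lam y * traceL E (K y (T y) * K y (T y)) -
      (ε * g y (T y) (T y) + fderiv ℝ α y (T y)) *
        (Module.finrank ℝ E * g y (T y) (T y) - lam y) := by
  conv_lhs => rw [h.K_T_mul_self hy, mul_add, mul_sub, mul_smul_comm, mul_smul_comm, mul_one,
    h.K_T_mul_smulRight hy]
  rw [map_add, map_sub, map_smul, map_smul, map_smul, h.trace_K_T hy, traceL_smulRight]
  simp only [_root_.add_apply, _root_.smul_apply, smul_eq_mul]
  ring

/-- The coordinate derivative differs from the covariant one by a commutator with `G y (T y)`. That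
commutator drops out of every trace against a power of K_T, so the following trace formulas contain
no Christoffel terms. -/
theorem fderiv_K_T_T : fderiv ℝ (fun z => K z (T z)) y (T y) =
    (fderiv ℝ lam y).smulRight (T y) + α y • (lam y • (1 : E →L[ℝ] E) - K y (T y))
      - G y (T y) * K y (T y) + K y (T y) * G y (T y) := by
  ext u
  have := h.covariant_T_K_T hy u
  simp only [mul_apply_eq_comp, _root_.add_apply, _root_.sub_apply, _root_.smul_apply,
    one_apply_eq_self, ContinuousLinearMap.smulRight_apply]
  linear_combination (norm := module) this

theorem trace_fderiv : traceL E (fderiv ℝ (fun z => K z (T z)) y (T y)) =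
    fderiv ℝ lam y (T y) + α y *
      (lam y * Module.finrank ℝ E - Module.finrank ℝ E * g y (T y) (T y)) := by
  rw [h.fderiv_K_T_T hy, map_add, map_sub, map_add, map_smul, map_sub, map_smul, traceL_one,
    traceL_smulRight, h.trace_K_T hy, traceL_mul_comm (G y (T y))]
  simp only [smul_eq_mul]
  ring

theorem trace_K_T_fderiv : traceL E (K y (T y) * fderiv ℝ (fun z => K z (T z)) y (T y)) =
    lam y * fderiv ℝ lam y (T y) + α y * (lam y * (Module.finrank ℝ E * g y (T y) (T y)) -
      traceL E (K y (T y) * K y (T y))) := by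
  rw [h.fderiv_K_T_T hy, mul_add, mul_sub, mul_add, h.K_T_mul_smulRight hy, mul_smul_comm, mul_sub,
    mul_smul_comm, mul_one, map_add, map_sub, map_add, map_smul, map_smul, map_sub, map_smul,
    traceL_smulRight, h.trace_K_T hy, ← mul_assoc, traceL_mul_comm (_ * _) (K y (T y))]
  simp only [smul_eq_mul]
  ring

theorem trace_K_T_sq_fderiv :
    traceL E (K y (T y) * (K y (T y) * fderiv ℝ (fun z => K z (T z)) y (T y))) =
      lam y ^ 2 * fderiv ℝ lam y (T y) + α y * (lam y * traceL E (K y (T y) * K y (T y)) -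
        traceL E (K y (T y) * (K y (T y) * K y (T y)))) := by
  have hcomm : traceL E (K y (T y) * (K y (T y) * (G y (T y) * K y (T y)))) =
      traceL E (K y (T y) * (K y (T y) * (K y (T y) * G y (T y)))) := by
    rw [← mul_assoc, ← mul_assoc, traceL_mul_comm]
    simp only [mul_assoc]
  rw [h.fderiv_K_T_T hy]
  simp only [mul_add, mul_sub, mul_smul_comm, mul_one, h.K_T_mul_smulRight hy, map_add, map_sub,
    map_smul, traceL_smulRight, hcomm, smul_eq_mul]
  ring

theorem differentiableAt_K_T : DifferentiableAt ℝ (fun z => K z (T z)) y :=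
  (h.differentiableAt_K hy).clm_apply (h.differentiableAt_T hy)

theorem contDiffAt_normSq : ContDiffAt ℝ ∞ (fun z => g z (T z) (T z)) y :=
  ((h.g_smooth.contDiffAt (h.mem_nhds hy)).clm_apply (h.T_smooth.contDiffAt (h.mem_nhds hy))).clm_apply
    (h.T_smooth.contDiffAt (h.mem_nhds hy))

theorem contDiffAt_fderiv_α_T : ContDiffAt ℝ ∞ (fun z => fderiv ℝ α z (T z)) y :=
  ((h.α_smooth.contDiffAt (h.mem_nhds hy)).fderiv_right (m := ∞) (by simp)).clm_apply
    (h.T_smooth.contDiffAt (h.mem_nhds hy))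

/-- The derivative along T of tr K_T = nq is computed once from q' = 2αq and once from the evolution
law. -/
theorem three_mul_α_normSq : 3 * α y * (Module.finrank ℝ E * g y (T y) (T y)) =
    fderiv ℝ lam y (T y) + Module.finrank ℝ E * α y * lam y := by
  have h1 : (fun z => traceL E (K z (T z))) =ᶠ[𝓝 y]
      fun z => (Module.finrank ℝ E : ℝ) * g z (T z) (T z) := by
    filter_upwards [h.mem_nhds hy] with z hz using h.trace_K_T hz
  have h2 : HasFDerivAt (fun z => traceL E (K z (T z)))
      ((traceL E).comp (fderiv ℝ (fun z => K z (T z)) y)) y :=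
    (traceL E).hasFDerivAt.comp y (h.differentiableAt_K_T hy).hasFDerivAt
  have h3 := congrArg (fun f : E →L[ℝ] ℝ => f (T y)) h1.fderiv_eq
  rw [h2.fderiv, fderiv_const_mul ((h.contDiffAt_normSq hy).differentiableAt (by simp))] at h3
  simp only [ContinuousLinearMap.comp_apply, _root_.smul_apply, h.fderiv_normSq hy, smul_eq_mul,
    h.trace_fderiv hy] at h3
  linear_combination -h3

/-- Wherever `K_T` is not a multiple of the identity on the orthogonal complement of `T`,
`T(lam) = α lam`. -/
theorem discriminant_mul :
    ((Module.finrank ℝ E - 1) * lam y * (Module.finrank ℝ E * g y (T y) (T y) - lam y) -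
      (Module.finrank ℝ E - 1) ^ 2 * (ε * g y (T y) (T y) + fderiv ℝ α y (T y)) -
      (Module.finrank ℝ E * g y (T y) (T y) - lam y) ^ 2) *
    (fderiv ℝ lam y (T y) - α y * lam y) = 0 := by
  have hq : DifferentiableAt ℝ (fun z => g z (T z) (T z)) y :=
    (h.contDiffAt_normSq hy).differentiableAt (by simp)
  have ha : DifferentiableAt ℝ (fun z => fderiv ℝ α z (T z)) y :=
    (h.contDiffAt_fderiv_α_T hy).differentiableAt (by simp)
  have hl := h.differentiableAt_lam hy
  have hc : DifferentiableAt ℝ (fun z => ε * g z (T z) (T z) + fderiv ℝ α z (T z)) y :=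
    (hq.const_mul ε).add ha
  have hs : DifferentiableAt ℝ (fun z => (Module.finrank ℝ E : ℝ) * g z (T z) (T z) - lam z) y :=
    (hq.const_mul _).sub hl
  have ht2 : (fun z => traceL E (K z (T z) * K z (T z))) =ᶠ[𝓝 y] fun z =>
      lam z * (Module.finrank ℝ E * g z (T z) (T z)) -
        (Module.finrank ℝ E - 1) * (ε * g z (T z) (T z) + fderiv ℝ α z (T z)) := by
    filter_upwards [h.mem_nhds hy] with z hz using h.trace_K_T_sq hz
  have ht3 : (fun z => traceL E (K z (T z) * (K z (T z) * K z (T z)))) =ᶠ[𝓝 y] fun z =>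
      lam z * traceL E (K z (T z) * K z (T z)) - (ε * g z (T z) (T z) + fderiv ℝ α z (T z)) *
        (Module.finrank ℝ E * g z (T z) (T z) - lam z) := by
    filter_upwards [h.mem_nhds hy] with z hz using h.trace_K_T_cube hz
  have hd2 : DifferentiableAt ℝ (fun z => traceL E (K z (T z) * K z (T z))) y :=
    (traceL E).differentiableAt.comp y
      ((h.differentiableAt_K_T hy).mul (h.differentiableAt_K_T hy))
  have e2 := congrArg (fun f : E →L[ℝ] ℝ => f (T y)) ht2.fderiv_eq
  have e3 := congrArg (fun f : E →L[ℝ] ℝ => f (T y)) ht3.fderiv_eq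
  rw [fderiv_fun_sub (hl.fun_mul (hq.const_mul _)) (hc.const_mul _), fderiv_fun_mul hl (hq.const_mul _),
    fderiv_const_mul hc, fderiv_const_mul hq] at e2
  rw [fderiv_fun_sub (hl.fun_mul hd2) (hc.fun_mul hs), fderiv_fun_mul hl hd2, fderiv_fun_mul hc hs,
    fderiv_fun_sub (hq.const_mul _) hl, fderiv_const_mul hq] at e3
  simp only [_root_.add_apply, _root_.sub_apply, _root_.smul_apply, smul_eq_mul,
    fderiv_trace_sq _ traceL_mul_comm (h.differentiableAt_K_T hy),
    fderiv_trace_cube _ traceL_mul_comm (h.differentiableAt_K_T hy), h.trace_K_T_fderiv hy, h.trace_K_T_sq_fderiv hy,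
    h.trace_K_T_cube hy, h.trace_K_T_sq hy, h.fderiv_normSq hy] at e2 e3
  have e1 := h.three_mul_α_normSq hy
  have e1' : fderiv ℝ lam y (T y) = 3 * α y * (Module.finrank ℝ E * g y (T y) (T y)) -
    Module.finrank ℝ E * α y * lam y := by linarith
  rw [e1'] at e2 e3 ⊢
  set n : ℝ := (Module.finrank ℝ E : ℝ)
  -- The derivative of εq + T(α), hence a second derivative of α, enters `e2` with factor −(n − 1)
  -- and `e3` with factor −(nq − λ); these multipliers eliminate it.
  linear_combination (n * g y (T y) (T y) - lam y) * e2 - (n - 1) * e3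

end LocalTchebychev
end Centroaffine
end

/-! ### The spectrum of K_T on the complement of T, and unique continuation for (T, α). -/

noncomputable section

namespace Centroaffine

variable {E : Type*} [NormedAddCommGroup E] [NormedSpace ℝ E] [FiniteDimensional ℝ E]

/-- With `q = ‖T‖²` and `a = T(α)`: `(n - 1)²` times the variance of the eigenvalues of `K_T` on the
orthogonal complement of `T`. -/
def spread (n ε q lam a : ℝ) : ℝ :=
  (n - 1) * lam * (n * q - lam) - (n - 1) ^ 2 * (ε * q + a) - (n * q - lam) ^ 2

section LinearAlgebra

variable {g : E →L[ℝ] E →L[ℝ] ℝ} (hsymm : ∀ v w, g v w = g w v)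
  {L : E →L[ℝ] E} (hL : ∀ v w, g (L v) w = g v (L w)) {t : E} (ht : g t t ≠ 0) {lam : ℝ}
  (hLt : L t = lam • t)

include hsymm hL ht hLt

omit hL in
theorem trace_eq_of_orth_scalar {μ : ℝ} (hμ : ∀ v, g v t = 0 → L v = μ • v) :
    traceL E L = lam + (Module.finrank ℝ E - 1) * μ := by
  have h1 : L = μ • (1 : E →L[ℝ] E) + ((lam - μ) / g t t) • (g t).smulRight t := by
    ext v
    have h2 := hμ (v - (g t v / g t t) • t) (by
      rw [map_sub, map_smul, _root_.sub_apply, _root_.smul_apply, smul_eq_mul,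
        div_mul_cancel₀ _ ht, hsymm, sub_self])
    rw [map_sub, map_smul, hLt] at h2
    simp only [_root_.add_apply, _root_.smul_apply, one_apply_eq_self,
      ContinuousLinearMap.smulRight_apply]
    linear_combination (norm := module) h2
  rw [h1, map_add, map_smul, map_smul, traceL_one, traceL_smulRight]
  simp only [smul_eq_mul]
  field_simp
  ring

/-- The expression is tr A² for the self-adjoint operator A that equals L − μ on the complement of t
and kills t. -/
theorem variance_nonneg (hpos : ∀ v, v ≠ 0 → 0 < g v v) (μ : ℝ) :
    0 ≤ traceL E (L * L) - 2 * μ * traceL E L + Module.finrank ℝ E * μ ^ 2 - (lam - μ) ^ 2 ∧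
    (traceL E (L * L) - 2 * μ * traceL E L + Module.finrank ℝ E * μ ^ 2 - (lam - μ) ^ 2 = 0 →
      ∀ v, g v t = 0 → L v = μ • v) := by
  set Q : E →L[ℝ] E := (g t).smulRight t with hQ
  set A : E →L[ℝ] E := L - μ • (1 : E →L[ℝ] E) - ((lam - μ) / g t t) • Q with hA
  have hQL : Q * L = lam • Q := by
    ext v
    simp only [hQ, mul_apply_eq_comp, ContinuousLinearMap.smulRight_apply, _root_.smul_apply]
    rw [← hL, hLt, map_smul, _root_.smul_apply, smul_eq_mul, mul_smul]
  have hLQ : L * Q = lam • Q := by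
    ext v
    simp [hQ, mul_apply_eq_comp, hLt, smul_comm lam]
  have hQQ : Q * Q = g t t • Q := by
    ext v
    simp only [hQ, mul_apply_eq_comp, ContinuousLinearMap.smulRight_apply, _root_.smul_apply,
      map_smul, smul_smul]
    rw [mul_comm]
  have hself : ∀ v w, g (A v) w = g v (A w) := by
    intro v w
    have h1 := hsymm v t
    simp only [hA, hQ, _root_.sub_apply, _root_.smul_apply, one_apply_eq_self,
      ContinuousLinearMap.smulRight_apply, map_sub, map_smul, smul_eq_mul]
    linear_combination hL v w + ((lam - μ) / g t t) * g t w * h1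
  have htrQ : traceL E Q = g t t := traceL_smulRight _ _
  have htr : traceL E (A * A) =
      traceL E (L * L) - 2 * μ * traceL E L + Module.finrank ℝ E * μ ^ 2 - (lam - μ) ^ 2 := by
    simp only [hA, mul_sub, sub_mul, mul_smul_comm, smul_mul_assoc, mul_one, one_mul, hQL, hLQ, hQQ,
      map_sub, map_smul, htrQ, traceL_one, smul_eq_mul]
    field_simp
    ring
  obtain ⟨h1, h2⟩ := traceL_mul_self_of_selfAdjoint g hsymm hpos A hself
  rw [htr] at h1 h2
  refine ⟨h1, fun h0 v hv => ?_⟩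
  have h3 := congrArg (fun B : E →L[ℝ] E => B v) (h2 h0)
  simp only [hA, hQ, _root_.sub_apply, _root_.smul_apply, one_apply_eq_self,
    ContinuousLinearMap.smulRight_apply, hsymm t v, hv, zero_smul, smul_zero, sub_zero,
    _root_.zero_apply] at h3
  exact sub_eq_zero.1 h3

end LinearAlgebra

namespace LocalTchebychev

variable {ε : ℝ} {Ω : Set E} {g : E → E →L[ℝ] E →L[ℝ] ℝ} {G K : E → E →L[ℝ] E →L[ℝ] E}
  {T : E → E} {α lam : E → ℝ} (h : LocalTchebychev ε Ω g G K T α lam) {y : E} (hy : y ∈ Ω)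
  (hn : 1 < Module.finrank ℝ E)

include h hy

/-- Here μ = (nq − λ)/(n − 1) is the mean of the eigenvalues of K_T on the complement of T, so
`variance_nonneg` becomes a statement about `spread`. -/
theorem variance_eq (hn : 1 < Module.finrank ℝ E) :
    traceL E (K y (T y) * K y (T y)) - 2 * ((Module.finrank ℝ E * g y (T y) (T y) - lam y) /
      (Module.finrank ℝ E - 1)) * traceL E (K y (T y)) + Module.finrank ℝ E *
        ((Module.finrank ℝ E * g y (T y) (T y) - lam y) / (Module.finrank ℝ E - 1)) ^ 2 -
        (lam y - (Module.finrank ℝ E * g y (T y) (T y) - lam y) / (Module.finrank ℝ E - 1)) ^ 2 =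
    spread (Module.finrank ℝ E) ε (g y (T y) (T y)) (lam y) (fderiv ℝ α y (T y)) /
      (Module.finrank ℝ E - 1) := by
  have hm : (Module.finrank ℝ E : ℝ) - 1 ≠ 0 := by
    have : (1 : ℝ) < Module.finrank ℝ E := by exact_mod_cast hn
    linarith
  rw [h.trace_K_T_sq hy, h.trace_K_T hy, spread]
  field_simp
  ring

theorem normSq_ne_zero (hT : T y ≠ 0) : g y (T y) (T y) ≠ 0 := (h.g_pos y hy _ hT).ne'

include hn

theorem spread_nonneg (hT : T y ≠ 0) :
    0 ≤ spread (Module.finrank ℝ E) ε (g y (T y) (T y)) (lam y) (fderiv ℝ α y (T y)) := by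
  have hm : (0 : ℝ) < (Module.finrank ℝ E : ℝ) - 1 := by
    have : (1 : ℝ) < Module.finrank ℝ E := by exact_mod_cast hn
    linarith
  have h1 := (variance_nonneg (h.g_symm y hy) (h.K_self y hy (T y)) (h.normSq_ne_zero hy hT)
    (h.eigen y hy) (h.g_pos y hy) ((Module.finrank ℝ E * g y (T y) (T y) - lam y) /
      (Module.finrank ℝ E - 1))).1
  rw [h.variance_eq hy hn] at h1
  have h2 := mul_nonneg h1 hm.le
  rwa [div_mul_cancel₀ _ hm.ne'] at h2

theorem K_T_apply_of_spread_eq_zero (hT : T y ≠ 0)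
    (h0 : spread (Module.finrank ℝ E) ε (g y (T y) (T y)) (lam y) (fderiv ℝ α y (T y)) = 0)
    {v : E} (hv : g y v (T y) = 0) : K y (T y) v =
      ((Module.finrank ℝ E * g y (T y) (T y) - lam y) / (Module.finrank ℝ E - 1)) • v := by
  refine (variance_nonneg (h.g_symm y hy) (h.K_self y hy (T y)) (h.normSq_ne_zero hy hT)
    (h.eigen y hy) (h.g_pos y hy) _).2 ?_ v hv
  rw [h.variance_eq hy hn, h0, zero_div]

omit hn in
-- On the complement of T, (L − c)(L − (λ − c)) = 0 for every root c of the quadratic. If c were not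
-- an eigenvalue, L would be the scalar λ − c there, and the spread would vanish.
theorem eigenvalue_iff_of_spread_ne_zero (hT : T y ≠ 0)
    (h0 : spread (Module.finrank ℝ E) ε (g y (T y) (T y)) (lam y) (fderiv ℝ α y (T y)) ≠ 0)
    (c : ℝ) : (∃ v, g y v (T y) = 0 ∧ v ≠ 0 ∧ K y (T y) v = c • v) ↔
      c ^ 2 - lam y * c + (ε * g y (T y) (T y) + fderiv ℝ α y (T y)) = 0 := by
  have hq := h.normSq_ne_zero hy hT
  have hdα : ∀ v, g y v (T y) = 0 → fderiv ℝ α y v = 0 := by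
    intro v hv
    have := h.fderiv_α hy v
    rw [h.g_symm y hy _ v, hv, mul_zero] at this
    exact (mul_eq_zero.1 this).resolve_right hq
  have hquad : ∀ v, g y v (T y) = 0 → K y (T y) (K y (T y) v) =
      lam y • K y (T y) v - (ε * g y (T y) (T y) + fderiv ℝ α y (T y)) • v := by
    intro v hv
    have h1 := congrArg (fun B : E →L[ℝ] E => B v) (h.K_T_mul_self hy)
    simpa only [mul_apply_eq_comp, _root_.add_apply, _root_.sub_apply, _root_.smul_apply,
      one_apply_eq_self, ContinuousLinearMap.smulRight_apply, hdα v hv, h.g_symm y hy (T y) v, hv,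
      smul_zero, add_zero, zero_smul] using h1
  constructor
  · rintro ⟨v, hv, hv0, hc⟩
    have h1 := hquad v hv
    rw [hc, map_smul, hc] at h1
    have h2 : (c ^ 2 - lam y * c + (ε * g y (T y) (T y) + fderiv ℝ α y (T y))) • v = 0 := by
      linear_combination (norm := module) h1
    exact (smul_eq_zero.1 h2).resolve_right hv0
  · intro hc
    by_contra hne
    push Not at hne
    apply h0
    have hscalar : ∀ v, g y v (T y) = 0 → K y (T y) v = (lam y - c) • v := by
      intro v hv
      by_contra hv1
      -- Otherwise Lv − (λ − c)v is a nonzero vector annihilated by L − c, hence an eigenvector for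
      -- c.
      refine hne (K y (T y) v - (lam y - c) • v) ?_ (sub_ne_zero.2 hv1) ?_
      · have h1 := h.K_self y hy (T y) v (T y)
        rw [h.eigen y hy, map_smul, hv, smul_zero] at h1
        simp [h1, hv]
      · rw [map_sub, map_smul, hquad v hv]
        have h2 : (c ^ 2 - lam y * c + (ε * g y (T y) (T y) + fderiv ℝ α y (T y))) • v = 0 := by
          rw [hc, zero_smul]
        linear_combination (norm := module) -h2
    have htr := trace_eq_of_orth_scalar (h.g_symm y hy) hq (h.eigen y hy)
      hscalar
    rw [h.trace_K_T hy] at htr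
    rw [spread, htr]
    linear_combination -(Module.finrank ℝ E - 1 : ℝ) ^ 2 * hc

omit hn in
-- This is the trace of `gauss_T` over v. Unlike `fderiv_α`, it bounds dα by T also at zeros of T.
theorem fderiv_α_eq (u : E) : (Module.finrank ℝ E - 1) * fderiv ℝ α y u =
    ε * (1 - Module.finrank ℝ E) * g y u (T y) - traceL E (K y u * K y (T y)) +
      traceL E (K y (K y u (T y))) := by
  have h1 : fderiv ℝ α y u • (1 : E →L[ℝ] E) - (fderiv ℝ α y).smulRight u =
      ε • (g y (T y)).smulRight u - (ε * g y u (T y)) • (1 : E →L[ℝ] E) - K y u * K y (T y) +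
        K y (K y u (T y)) := by
    ext v
    have h2 := h.gauss_T hy u v
    rw [h.K_symm y hy v, h.K_symm y hy v, h.g_symm y hy v, mul_smul] at h2
    simpa [mul_apply_eq_comp] using h2
  have h3 := congrArg (traceL E) h1
  simp only [map_sub, map_add, map_smul, traceL_one, traceL_smulRight, smul_eq_mul] at h3
  rw [h.g_symm y hy (T y) u] at h3
  linear_combination h3

/-- The equations ∇̂T = α·id and `fderiv_α_eq` form a homogeneous linear system for (T, α) with
locally bounded coefficients, so Gronwall applies. -/
theorem eventually_eq_zero (hT : T y = 0) (hα : α y = 0) :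
    ∀ᶠ z in 𝓝 y, T z = 0 ∧ α z = 0 := by
  have hm : (0 : ℝ) < (Module.finrank ℝ E : ℝ) - 1 := by
    have : (1 : ℝ) < Module.finrank ℝ E := by exact_mod_cast hn
    linarith
  set n : ℝ := (Module.finrank ℝ E : ℝ) with hndef
  set b : E → ℝ := fun z => (|ε * (1 - n)| * ‖g z‖ + 2 * ‖traceL E‖ * ‖K z‖ ^ 2) / (n - 1) with hb
  have hdα : ∀ z ∈ Ω, ‖fderiv ℝ α z‖ ≤ b z * ‖T z‖ := by
    intro z hz
    have hb0 : 0 ≤ b z := by positivity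
    refine ContinuousLinearMap.opNorm_le_bound _ (by positivity) fun u => ?_
    have h1 := h.fderiv_α_eq hz u
    rw [← hndef] at h1
    have e1 : ‖g z u (T z)‖ ≤ ‖g z‖ * ‖u‖ * ‖T z‖ := (g z).le_opNorm₂ u (T z)
    have e2 : ‖traceL E (K z u * K z (T z))‖ ≤ ‖traceL E‖ * ((‖K z‖ * ‖u‖) * (‖K z‖ * ‖T z‖)) :=
      ((traceL E).le_opNorm _).trans (by
        gcongr
        exact (norm_mul_le _ _).trans (mul_le_mul ((K z).le_opNorm u) ((K z).le_opNorm (T z))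
          (norm_nonneg _) (by positivity)))
    have e3 : ‖traceL E (K z (K z u (T z)))‖ ≤ ‖traceL E‖ * (‖K z‖ * (‖K z‖ * ‖u‖ * ‖T z‖)) :=
      ((traceL E).le_opNorm _).trans (by
        gcongr
        exact ((K z).le_opNorm _).trans (by gcongr; exact (K z).le_opNorm₂ u (T z)))
    have e4 : (n - 1) * ‖fderiv ℝ α z u‖ ≤ |ε * (1 - n)| * (‖g z‖ * ‖u‖ * ‖T z‖) +
        ‖traceL E‖ * ((‖K z‖ * ‖u‖) * (‖K z‖ * ‖T z‖)) +
        ‖traceL E‖ * (‖K z‖ * (‖K z‖ * ‖u‖ * ‖T z‖)) := by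
      calc (n - 1) * ‖fderiv ℝ α z u‖ = ‖(n - 1) * fderiv ℝ α z u‖ := by
            rw [norm_mul, Real.norm_eq_abs (n - 1), abs_of_pos hm]
        _ ≤ ‖ε * (1 - n) * g z u (T z)‖ + ‖traceL E (K z u * K z (T z))‖ +
            ‖traceL E (K z (K z u (T z)))‖ := by
            rw [h1]
            exact (norm_add_le _ _).trans (by gcongr; exact norm_sub_le _ _)
        _ ≤ _ := by
            rw [norm_mul, Real.norm_eq_abs (ε * (1 - n))]
            gcongr
    have e5 : b z * ‖T z‖ * ‖u‖ = (|ε * (1 - n)| * (‖g z‖ * ‖u‖ * ‖T z‖) +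
        ‖traceL E‖ * ((‖K z‖ * ‖u‖) * (‖K z‖ * ‖T z‖)) +
        ‖traceL E‖ * (‖K z‖ * (‖K z‖ * ‖u‖ * ‖T z‖))) / (n - 1) := by
      rw [hb]
      field_simp
      ring
    rw [e5, le_div_iff₀ hm]
    linarith
  have hdT : ∀ z ∈ Ω, ‖fderiv ℝ T z‖ ≤ |α z| + ‖G z‖ * ‖T z‖ := by
    intro z hz
    refine ContinuousLinearMap.opNorm_le_bound _ (by positivity) fun u => ?_
    rw [h.fderiv_T z hz]
    refine (norm_sub_le _ _).trans ?_
    have e1 := (G z).le_opNorm₂ u (T z)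
    rw [norm_smul, Real.norm_eq_abs]
    linarith
  have hcont : ContinuousAt (fun z => b z + ‖G z‖ + 1) y := by
    have h1 : ContinuousAt (fun z => ‖g z‖) y :=
      (continuous_norm (E := E →L[ℝ] E →L[ℝ] ℝ)).continuousAt.comp
        (h.differentiableAt_g hy).continuousAt
    have h2 : ContinuousAt (fun z => ‖K z‖) y :=
      (continuous_norm (E := E →L[ℝ] E →L[ℝ] E)).continuousAt.comp
        (h.differentiableAt_K hy).continuousAt
    have h3 : ContinuousAt (fun z => ‖G z‖) y :=
      (continuous_norm (E := E →L[ℝ] E →L[ℝ] E)).continuousAt.comp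
        (h.differentiableAt_G hy).continuousAt
    exact (((((h1.const_mul _).add ((h2.pow 2).const_mul _)).div_const _).add h3).add
      continuousAt_const)
  obtain ⟨r, hr, hball⟩ := Metric.eventually_nhds_iff_ball.1
    ((hcont.eventually (gt_mem_nhds (lt_add_one _))).and (h.mem_nhds hy))
  -- Continuity keeps b + ‖G‖ + 1 below C on the ball. The first 1 accounts for the term |α| in the
  -- bound for dT, the second is the margin.
  set C := b y + ‖G y‖ + 1 + 1
  have hW : ∀ z ∈ Metric.ball y r, HasFDerivAt (fun z => (T z, α z))
      ((fderiv ℝ T z).prod (fderiv ℝ α z)) z := fun z hz =>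
    (h.differentiableAt_T (hball z hz).2).hasFDerivAt.prodMk
      (h.differentiableAt_α (hball z hz).2).hasFDerivAt
  have key := eqOn_zero_of_norm_fderiv_le (f := fun z => (T z, α z)) (y₀ := y) (r := r) (C := C)
    (fun z hz => (hW z hz).differentiableAt) (by
      intro z hz
      have hzΩ := (hball z hz).2
      have hzC := (hball z hz).1
      have hb0 : 0 ≤ b z := by positivity
      have hT1 : ‖T z‖ ≤ ‖(T z, α z)‖ := norm_fst_le (T z, α z)
      have hα1 : |α z| ≤ ‖(T z, α z)‖ := norm_snd_le (T z, α z)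
      rw [(hW z hz).fderiv, ContinuousLinearMap.opNorm_prod]
      have h1 := norm_nonneg (G z)
      have h2 := norm_nonneg (T z, α z)
      refine max_le ?_ ?_
      · refine (hdT z hzΩ).trans ?_
        nlinarith [mul_le_mul_of_nonneg_left hT1 h1]
      · refine (hdα z hzΩ).trans ?_
        nlinarith [mul_le_mul_of_nonneg_left hT1 hb0]) (by simp [hT, hα])
  filter_upwards [Metric.ball_mem_nhds y hr] with z hz
  simpa using key z hz

end LocalTchebychev
end Centroaffine
end

/-! ### The invariants of a centroaffine immersion of an open set, and their structure equations. -/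

noncomputable section

namespace Centroaffine

variable {E F : Type*} [NormedAddCommGroup E] [NormedSpace ℝ E] [FiniteDimensional ℝ E]
  [NormedAddCommGroup F] [NormedSpace ℝ F]

theorem isInvertible_of_posDef {g : E →L[ℝ] E →L[ℝ] ℝ} (hpos : ∀ v, v ≠ 0 → 0 < g v v) :
    g.IsInvertible := by
  have hinj : Function.Injective (g : E →ₗ[ℝ] E →L[ℝ] ℝ) := by
    rw [injective_iff_map_eq_zero]
    intro v hv
    by_contra hne
    have h1 := hpos v hne
    have h2 : g v = 0 := hv
    rw [h2] at h1
    exact lt_irrefl _ h1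
  have hrank : Module.finrank ℝ E = Module.finrank ℝ (E →L[ℝ] ℝ) := by
    rw [← (LinearMap.toContinuousLinearMap : (E →ₗ[ℝ] ℝ) ≃ₗ[ℝ] E →L[ℝ] ℝ).finrank_eq]
    exact (Subspace.dual_finrank_eq (K := ℝ) (V := E)).symm
  exact ⟨(LinearMap.linearEquivOfInjective _ hinj hrank).toContinuousLinearEquiv, rfl⟩

set_option maxSynthPendingDepth 3

section Definitions

variable (f : E → F) (ε : ℝ) (y : E)

/-- The splitting of the ambient space, in coordinates. -/
def coordSplitting : E × ℝ →L[ℝ] F :=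
  (fderiv ℝ f y).coprod (ContinuousLinearMap.toSpanSingleton ℝ (-(ε • f y)))

/-- The Christoffel form of the induced connection, in coordinates. -/
def coordChristoffel : E →L[ℝ] E →L[ℝ] E :=
  (ContinuousLinearMap.compL ℝ E F E
    ((ContinuousLinearMap.fst ℝ E ℝ).comp (coordSplitting f ε y).inverse)).comp
      (fderiv ℝ (fderiv ℝ f) y)

/-- The centroaffine metric, in coordinates. -/
def coordMetric : E →L[ℝ] E →L[ℝ] ℝ :=
  (ContinuousLinearMap.compL ℝ E F ℝ
    ((ContinuousLinearMap.snd ℝ E ℝ).comp (coordSplitting f ε y).inverse)).comp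
      (fderiv ℝ (fderiv ℝ f) y)

/-- The cubic form `∇h`, in coordinates. -/
def coordCubic : E →L[ℝ] E →L[ℝ] E →L[ℝ] ℝ :=
  letI A : E →L[ℝ] E →L[ℝ] E →L[ℝ] ℝ :=
    (ContinuousLinearMap.compL ℝ E E (E →L[ℝ] ℝ) (coordMetric f ε y)).comp (coordChristoffel f ε y)
  letI B : E →L[ℝ] E →L[ℝ] E →L[ℝ] ℝ :=
    ((ContinuousLinearMap.compL ℝ E (E →L[ℝ] ℝ) (E →L[ℝ] ℝ)).flip (coordMetric f ε y)).comp
      ((ContinuousLinearMap.compL ℝ E E ℝ).flip.comp (coordChristoffel f ε y))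
  fderiv ℝ (coordMetric f ε) y - A - B

/-- The difference tensor, in coordinates. -/
def coordDifference : E →L[ℝ] E →L[ℝ] E :=
  -- The factor −1/2 reflects ∇h(u, v, w) = −2h(K_u v, w), which follows from ∇̂h = 0 and the
  -- self-adjointness of K_u.
  (ContinuousLinearMap.compL ℝ E (E →L[ℝ] ℝ) E ((-1 / 2 : ℝ) • (coordMetric f ε y).inverse)).comp
    (coordCubic f ε y)

end Definitions

variable {f : E → F} {ε : ℝ} {y : E}

omit [FiniteDimensional ℝ E] in
theorem coordSplitting_apply (a : E) (t : ℝ) :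
    coordSplitting f ε y (a, t) = fderiv ℝ f y a - (t * ε) • f y := by
  simp [coordSplitting, smul_smul, sub_eq_add_neg]

omit [FiniteDimensional ℝ E] in
theorem coordCubic_apply (u v w : E) : coordCubic f ε y u v w =
    fderiv ℝ (coordMetric f ε) y u v w - coordMetric f ε y (coordChristoffel f ε y u v) w -
      coordMetric f ε y v (coordChristoffel f ε y u w) := by
  simp [coordCubic]

theorem coordMetric_coordDifference (hpos : ∀ v, v ≠ 0 → 0 < coordMetric f ε y v v) (u v w : E) :
    coordMetric f ε y (coordDifference f ε y u v) w = (-1 / 2) * coordCubic f ε y u v w := by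
  have h1 := (isInvertible_of_posDef hpos).self_comp_inverse
  have h2 := congrArg (fun A : (E →L[ℝ] ℝ) →L[ℝ] E →L[ℝ] ℝ => A (coordCubic f ε y u v) w) h1
  simp only [ContinuousLinearMap.comp_apply, ContinuousLinearMap.id_apply] at h2
  rw [← h2]
  simp [coordDifference]

omit [FiniteDimensional ℝ E] in
theorem fderiv_fderiv_eq (hS : (coordSplitting f ε y).IsInvertible) (u v : E) :
    fderiv ℝ (fderiv ℝ f) y u v = fderiv ℝ f y (coordChristoffel f ε y u v) -
      (coordMetric f ε y u v * ε) • f y := by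
  have h1 := congrArg (fun A : F →L[ℝ] F => A (fderiv ℝ (fderiv ℝ f) y u v)) hS.self_comp_inverse
  simp only [ContinuousLinearMap.comp_apply, ContinuousLinearMap.id_apply] at h1
  rw [← h1, ← coordSplitting_apply]
  rfl

section Smooth

variable {Ω : Set E} (hΩ : IsOpen Ω) (hf : ContDiffOn ℝ ∞ f Ω)
  (hS : ∀ y ∈ Ω, (coordSplitting f ε y).IsInvertible)

include hΩ hf hS

theorem contDiffOn_coordSplitting_inverse :
    ContDiffOn ℝ ∞ (fun y => (coordSplitting f ε y).inverse) Ω := by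
  have hD : ContDiffOn ℝ ∞ (fderiv ℝ f) Ω := hf.fderiv_of_isOpen hΩ (by simp)
  have h1 : ContDiffOn ℝ ∞ (coordSplitting f ε) Ω := by
    rw [contDiffOn_clm_apply]
    rintro ⟨a, t⟩
    simp only [coordSplitting_apply]
    exact (hD.clm_apply contDiffOn_const).sub (contDiffOn_const.smul hf)
  intro y hy
  exact (hS y hy).contDiffAt_map_inverse.comp_contDiffWithinAt y (h1 y hy)

theorem contDiffOn_coordChristoffel : ContDiffOn ℝ ∞ (coordChristoffel f ε) Ω := by
  have h2 : ContDiffOn ℝ ∞ (fderiv ℝ (fderiv ℝ f)) Ω :=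
    (hf.fderiv_of_isOpen (m := ∞) hΩ (by simp)).fderiv_of_isOpen hΩ (by simp)
  refine ContDiffOn.clm_comp ?_ h2
  exact (ContinuousLinearMap.contDiff _).comp_contDiffOn
    (contDiffOn_const.clm_comp (contDiffOn_coordSplitting_inverse hΩ hf hS))

theorem contDiffOn_coordMetric : ContDiffOn ℝ ∞ (coordMetric f ε) Ω := by
  have h2 : ContDiffOn ℝ ∞ (fderiv ℝ (fderiv ℝ f)) Ω :=
    (hf.fderiv_of_isOpen (m := ∞) hΩ (by simp)).fderiv_of_isOpen hΩ (by simp)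
  refine ContDiffOn.clm_comp ?_ h2
  exact (ContinuousLinearMap.contDiff _).comp_contDiffOn
    (contDiffOn_const.clm_comp (contDiffOn_coordSplitting_inverse hΩ hf hS))

theorem contDiffOn_coordDifference (hpos : ∀ y ∈ Ω, ∀ v, v ≠ 0 → 0 < coordMetric f ε y v v) :
    ContDiffOn ℝ ∞ (coordDifference f ε) Ω := by
  have hg := contDiffOn_coordMetric hΩ hf hS
  have hΓ := contDiffOn_coordChristoffel hΩ hf hS
  have hC : ContDiffOn ℝ ∞ (coordCubic f ε) Ω := by
    refine ((hg.fderiv_of_isOpen hΩ (by simp)).sub ?_).sub ?_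
    · exact ((ContinuousLinearMap.contDiff _).comp_contDiffOn hg).clm_comp hΓ
    · exact ((ContinuousLinearMap.contDiff _).comp_contDiffOn hg).clm_comp
        (contDiffOn_const.clm_comp hΓ)
  have hinv : ContDiffOn ℝ ∞ (fun y => (coordMetric f ε y).inverse) Ω := fun y hy =>
    (isInvertible_of_posDef (hpos y hy)).contDiffAt_map_inverse.comp_contDiffWithinAt y (hg y hy)
  exact ((ContinuousLinearMap.contDiff _).comp_contDiffOn (hinv.const_smul (-1 / 2 : ℝ))).clm_comp hC

/-- The structure equations, from the symmetry of the third derivative of `f`. -/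
theorem structure_equations (hy : y ∈ Ω) (u v w : E) :
    fderiv ℝ (coordChristoffel f ε) y u v w +
        coordChristoffel f ε y u (coordChristoffel f ε y v w) - (ε * coordMetric f ε y v w) • u =
      fderiv ℝ (coordChristoffel f ε) y v u w +
        coordChristoffel f ε y v (coordChristoffel f ε y u w) - (ε * coordMetric f ε y u w) • v ∧
    fderiv ℝ (coordMetric f ε) y u v w + coordMetric f ε y u (coordChristoffel f ε y v w) =
      fderiv ℝ (coordMetric f ε) y v u w + coordMetric f ε y v (coordChristoffel f ε y u w) := by
  have hn : Ω ∈ 𝓝 y := hΩ.mem_nhds hy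
  have hD : ContDiffOn ℝ ∞ (fderiv ℝ f) Ω := hf.fderiv_of_isOpen hΩ (by simp)
  have hdf : DifferentiableAt ℝ f y := (hf.contDiffAt hn).differentiableAt (by simp)
  have hdD : ∀ z ∈ Ω, DifferentiableAt ℝ (fderiv ℝ f) z := fun z hz =>
    (hD.contDiffAt (hΩ.mem_nhds hz)).differentiableAt (by simp)
  have hdg : DifferentiableAt ℝ (coordMetric f ε) y :=
    ((contDiffOn_coordMetric hΩ hf hS).contDiffAt hn).differentiableAt (by simp)
  have hdΓ : DifferentiableAt ℝ (coordChristoffel f ε) y :=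
    ((contDiffOn_coordChristoffel hΩ hf hS).contDiffAt hn).differentiableAt (by simp)
  have hC2 : ContDiffAt ℝ 2 (fun z => fderiv ℝ f z w) y :=
    ((hD.contDiffAt hn).clm_apply contDiffAt_const).of_le (by norm_cast)
  have h1 : ∀ v, (fun z => fderiv ℝ (fun z => fderiv ℝ f z w) z v) =ᶠ[𝓝 y] fun z =>
      fderiv ℝ f z (coordChristoffel f ε z v w) - (coordMetric f ε z v w * ε) • f z := by
    intro v
    filter_upwards [hn] with z hz
    rw [← fderiv_fderiv_eq (hS z hz), fderiv_clm_apply (hdD z hz) (differentiableAt_const w)]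
    simp
  have hda : ∀ v, DifferentiableAt ℝ (fun z => coordChristoffel f ε z v w) y := fun v =>
    hasFDerivAt_clm_apply₂ hdΓ (differentiableAt_const v) (differentiableAt_const w)
  have hdb : ∀ v, DifferentiableAt ℝ (fun z => coordMetric f ε z v w) y := fun v =>
    hasFDerivAt_clm_apply₂ hdg (differentiableAt_const v) (differentiableAt_const w)
  -- Differentiate the Gauss formula once more and split again. The tangential term −εg(v, w)u comes
  -- from differentiating the normal −εf; symmetry of the third derivatives then compares both
  -- components.
  have h2 : ∀ u v, fderiv ℝ (fun z => fderiv ℝ (fun z => fderiv ℝ f z w) z v) y u =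
      coordSplitting f ε y
        (fderiv ℝ (coordChristoffel f ε) y u v w +
          coordChristoffel f ε y u (coordChristoffel f ε y v w) - (ε * coordMetric f ε y v w) • u,
        fderiv ℝ (coordMetric f ε) y u v w +
          coordMetric f ε y u (coordChristoffel f ε y v w)) := by
    intro u v
    rw [(h1 v).fderiv_eq, fderiv_fun_sub ((hdD y hy).clm_apply (hda v))
      (((hdb v).mul_const ε).fun_smul hdf), fderiv_clm_apply (hdD y hy) (hda v),
      fderiv_fun_smul ((hdb v).mul_const ε) hdf, fderiv_mul_const (hdb v), coordSplitting_apply]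
    simp only [_root_.add_apply, _root_.sub_apply, ContinuousLinearMap.comp_apply,
      ContinuousLinearMap.flip_apply, _root_.smul_apply, ContinuousLinearMap.smulRight_apply,
      fderiv_fderiv_eq (hS y hy), fderiv_clm_apply₂ hdΓ (differentiableAt_const v)
        (differentiableAt_const w), fderiv_clm_apply₂ hdg (differentiableAt_const v)
        (differentiableAt_const w), map_add, map_sub, map_smul, smul_eq_mul]
    simp only [fderiv_fun_const, Pi.zero_apply, _root_.zero_apply, map_zero, add_zero]
    module
  have h3 := fderiv_fderiv_apply_comm hC2 v u
  rw [h2, h2] at h3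
  have hinj : Function.Injective (coordSplitting f ε y) := (hS y hy).injective
  have h4 := hinj h3
  exact ⟨congrArg Prod.fst h4, congrArg Prod.snd h4⟩

/-- The cubic form is totally symmetric: in its first two slots by the normal structure equation, in
the last two by symmetry of the metric. Hence K is symmetric and self-adjoint, and Γ − K is torsion
free and metric. -/
theorem localGeometry_of_immersion
    (hpos : ∀ y ∈ Ω, ∀ v, v ≠ 0 → 0 < coordMetric f ε y v v) :
    LocalGeometry ε Ω (coordMetric f ε)
      (fun y => coordChristoffel f ε y - coordDifference f ε y) (coordDifference f ε) := by
  have hsymm2 : ∀ y ∈ Ω, ∀ u v, fderiv ℝ (fderiv ℝ f) y u v = fderiv ℝ (fderiv ℝ f) y v u :=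
    fun y hy u v => ((hf.contDiffAt (hΩ.mem_nhds hy)).of_le (m := 2)
      (by norm_cast)).isSymmSndFDerivAt (by simp) u v
  have hg : ∀ y ∈ Ω, ∀ v w, coordMetric f ε y v w = coordMetric f ε y w v := by
    intro y hy v w
    simp [coordMetric, hsymm2 y hy v w]
  have hΓ : ∀ y ∈ Ω, ∀ v w, coordChristoffel f ε y v w = coordChristoffel f ε y w v := by
    intro y hy v w
    simp [coordChristoffel, hsymm2 y hy v w]
  have hdg : ∀ y ∈ Ω, ∀ u v w,
      fderiv ℝ (coordMetric f ε) y u v w = fderiv ℝ (coordMetric f ε) y u w v := by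
    intro y hy u v w
    have hd : DifferentiableAt ℝ (coordMetric f ε) y :=
      ((contDiffOn_coordMetric hΩ hf hS).contDiffAt (hΩ.mem_nhds hy)).differentiableAt (by simp)
    have h1 : ∀ v w, fderiv ℝ (fun z => coordMetric f ε z v w) y u =
        fderiv ℝ (coordMetric f ε) y u v w := by
      intro v w
      rw [fderiv_clm_apply₂ hd (differentiableAt_const v) (differentiableAt_const w)]
      simp
    have h2 : (fun z => coordMetric f ε z v w) =ᶠ[𝓝 y] fun z => coordMetric f ε z w v := by
      filter_upwards [hΩ.mem_nhds hy] with z hz using hg z hz v w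
    rw [← h1, ← h1, h2.fderiv_eq]
  have hC1 : ∀ y ∈ Ω, ∀ u v w, coordCubic f ε y u v w = coordCubic f ε y v u w := by
    intro y hy u v w
    rw [coordCubic_apply, coordCubic_apply, hΓ y hy v u]
    linear_combination (structure_equations hΩ hf hS hy u v w).2
  have hC2 : ∀ y ∈ Ω, ∀ u v w, coordCubic f ε y u v w = coordCubic f ε y u w v := by
    intro y hy u v w
    rw [coordCubic_apply, coordCubic_apply, hdg y hy, hg y hy v, hg y hy _ w]
    ring
  have hK : ∀ y ∈ Ω, ∀ u v, coordDifference f ε y u v = coordDifference f ε y v u := by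
    intro y hy u v
    have : coordCubic f ε y u v = coordCubic f ε y v u := by
      ext w
      exact hC1 y hy u v w
    simp [coordDifference, this]
  have hKsmooth := contDiffOn_coordDifference hΩ hf hS hpos
  have hΓsmooth := contDiffOn_coordChristoffel hΩ hf hS
  refine ⟨hΩ, contDiffOn_coordMetric hΩ hf hS, hΓsmooth.sub hKsmooth, hKsmooth, hg, hpos, ?_, hK,
    ?_, ?_, ?_⟩
  · intro y hy v w
    simp [hΓ y hy v w, hK y hy v w]
  · intro y hy u v w
    rw [coordMetric_coordDifference (hpos y hy), hg y hy, coordMetric_coordDifference (hpos y hy),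
      hC2 y hy]
  · intro y hy u v w
    have h1 := coordMetric_coordDifference (hpos y hy) u v w
    have h2 := coordMetric_coordDifference (hpos y hy) u w v
    have h3 := hg y hy v (coordDifference f ε y u w)
    have h4 := coordCubic_apply (f := f) (ε := ε) (y := y) u v w
    have h5 := hC2 y hy u v w
    simp only [_root_.sub_apply, map_sub]
    linear_combination h1 + h2 + h3 - h4 + h5 / 2
  · intro y hy u v w
    have hd1 : DifferentiableAt ℝ (coordChristoffel f ε) y :=
      (hΓsmooth.contDiffAt (hΩ.mem_nhds hy)).differentiableAt (by simp)
    have hd2 : DifferentiableAt ℝ (coordDifference f ε) y :=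
      (hKsmooth.contDiffAt (hΩ.mem_nhds hy)).differentiableAt (by simp)
    have h1 := (structure_equations hΩ hf hS hy u v w).1
    rw [fderiv_fun_sub hd1 hd2]
    simp only [_root_.sub_apply, map_sub]
    linear_combination (norm := module) h1

end Smooth

end Centroaffine
end

/-! ### Vector fields and derivatives on the manifold read in a chart. -/

noncomputable section

namespace Centroaffine

section Chart

variable {n : ℕ} {M : Type*} [TopologicalSpace M] [ChartedSpace (Model n) M]
  [IsManifold (𝓡 n) ∞ M]

/-- The derivative at `q` of the chart around `p₀`. -/
def chartDeriv (p₀ q : M) : TangentSpace (𝓡 n) q →L[ℝ] Model n :=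
  mvfderiv (𝓡 n) (extChartAt (𝓡 n) p₀) q

/-- A vector field read in the chart around `p₀`. -/
def chartField (p₀ : M) (Y : Π p : M, TangentSpace (𝓡 n) p) (y : Model n) : Model n :=
  chartDeriv p₀ ((extChartAt (𝓡 n) p₀).symm y) (Y ((extChartAt (𝓡 n) p₀).symm y))

variable {p₀ q : M} (hq : q ∈ (extChartAt (𝓡 n) p₀).source)

theorem chartDeriv_self (p : M) (v : TangentSpace (𝓡 n) p) : chartDeriv p p v = v := by
  have := congrArg (fun A => A v) (mfderiv_extChartAt_self (I := 𝓡 n) (x := p))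
  exact this

omit [IsManifold (𝓡 n) ∞ M] in
theorem chartField_apply {p₀ q : M} (Y : Π p : M, TangentSpace (𝓡 n) p)
    (hq : q ∈ (extChartAt (𝓡 n) p₀).source) :
    chartField p₀ Y (extChartAt (𝓡 n) p₀ q) = chartDeriv p₀ q (Y q) := by
  rw [chartField, (extChartAt (𝓡 n) p₀).left_inv hq]

include hq

theorem isInvertible_chartDeriv : (chartDeriv (n := n) p₀ q).IsInvertible := by
  have h1 := isInvertible_mfderiv_extChartAt (I := 𝓡 n) hq
  exact ContinuousLinearMap.isInvertible_equiv.comp h1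

theorem mdifferentiableAt_chart :
    MDifferentiableAt (𝓡 n) 𝓘(ℝ, Model n) (extChartAt (𝓡 n) p₀) q :=
  mdifferentiableAt_extChartAt (by rwa [extChartAt_source] at hq)

theorem mdifferentiableAt_chart_symm :
    MDifferentiableAt 𝓘(ℝ, Model n) (𝓡 n) (extChartAt (𝓡 n) p₀).symm (extChartAt (𝓡 n) p₀ q) := by
  have h1 := mdifferentiableWithinAt_extChartAt_symm (I := 𝓡 n)
    ((extChartAt (𝓡 n) p₀).map_source hq)
  rwa [ModelWithCorners.range_eq_univ, mdifferentiableWithinAt_univ] at h1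

omit [IsManifold (𝓡 n) ∞ M] in
theorem chart_target_mem_nhds :
    (extChartAt (𝓡 n) p₀).target ∈ 𝓝 (extChartAt (𝓡 n) p₀ q) :=
  (isOpen_extChartAt_target p₀).mem_nhds ((extChartAt (𝓡 n) p₀).map_source hq)

omit [IsManifold (𝓡 n) ∞ M] in
theorem chart_source_mem_nhds : (extChartAt (𝓡 n) p₀).source ∈ 𝓝 q :=
  (isOpen_extChartAt_source p₀).mem_nhds hq

omit [IsManifold (𝓡 n) ∞ M] in
theorem tendsto_chart :
    Filter.Tendsto (extChartAt (𝓡 n) p₀) (𝓝 q) (𝓝 (extChartAt (𝓡 n) p₀ q)) :=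
  continuousAt_extChartAt' hq

omit [IsManifold (𝓡 n) ∞ M] in
theorem tendsto_chart_symm :
    Filter.Tendsto (extChartAt (𝓡 n) p₀).symm (𝓝 (extChartAt (𝓡 n) p₀ q)) (𝓝 q) := by
  have h1 := continuousAt_extChartAt_symm'' ((extChartAt (𝓡 n) p₀).map_source hq)
  rw [ContinuousAt, (extChartAt (𝓡 n) p₀).left_inv hq] at h1
  exact h1

variable {V : Type*} [NormedAddCommGroup V] [NormedSpace ℝ V] {φ : M → V}

theorem mdifferentiableAt_iff_chart : MDifferentiableAt (𝓡 n) 𝓘(ℝ, V) φ q ↔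
    DifferentiableAt ℝ (φ ∘ (extChartAt (𝓡 n) p₀).symm) (extChartAt (𝓡 n) p₀ q) := by
  constructor
  · intro h
    rw [← mdifferentiableAt_iff_differentiableAt]
    refine MDifferentiableAt.comp _ ?_ (mdifferentiableAt_chart_symm hq)
    rwa [(extChartAt (𝓡 n) p₀).left_inv hq]
  · intro h
    rw [← mdifferentiableAt_iff_differentiableAt] at h
    refine (h.comp q (mdifferentiableAt_chart hq)).congr_of_eventuallyEq ?_
    filter_upwards [chart_source_mem_nhds hq] with z hz
    simp only [Function.comp_apply, (extChartAt (𝓡 n) p₀).left_inv hz]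

theorem mvfderiv_eq_chart (hφ : MDifferentiableAt (𝓡 n) 𝓘(ℝ, V) φ q)
    (v : TangentSpace (𝓡 n) q) : mvfderiv (𝓡 n) φ q v =
      fderiv ℝ (φ ∘ (extChartAt (𝓡 n) p₀).symm) (extChartAt (𝓡 n) p₀ q) (chartDeriv p₀ q v) := by
  have h1 := ((mdifferentiableAt_iff_chart hq).1 hφ).hasFDerivAt.hasMFDerivAt
  have h2 := h1.comp q (mdifferentiableAt_chart hq).hasMFDerivAt
  have h3 : φ =ᶠ[𝓝 q] (φ ∘ (extChartAt (𝓡 n) p₀).symm) ∘ extChartAt (𝓡 n) p₀ := by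
    filter_upwards [chart_source_mem_nhds hq] with z hz
    simp only [Function.comp_apply, (extChartAt (𝓡 n) p₀).left_inv hz]
  have h4 := (h2.congr_of_eventuallyEq h3).mfderiv
  rw [mvfderiv, h4]
  rfl

omit φ in
theorem diffAt_iff_chart {Y : Π p : M, TangentSpace (𝓡 n) p} :
    DiffAt Y q ↔ DifferentiableAt ℝ (chartField p₀ Y) (extChartAt (𝓡 n) p₀ q) := by
  have hq' : q ∈ (chartAt (Model n) p₀).source := by rwa [extChartAt_source] at hq
  rw [DiffAt, Bundle.Trivialization.mdifferentiableAt_section_iff (𝓡 n)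
    (trivializationAt (Model n) (TangentSpace (𝓡 n)) p₀) Y (by simpa using hq')]
  have h1 : (fun z => (trivializationAt (Model n) (TangentSpace (𝓡 n)) p₀
      ⟨z, Y z⟩).2) =ᶠ[𝓝 q] fun z => chartDeriv p₀ z (Y z) := by
    filter_upwards [(chartAt (Model n) p₀).open_source.mem_nhds hq'] with z hz
    have h2 := congrArg (fun A => A (Y z))
      (TangentBundle.continuousLinearMapAt_trivializationAt (𝕜 := ℝ) (I := 𝓡 n) hz)
    rw [← Bundle.Trivialization.continuousLinearMapAt_apply_of_mem ℝ _ (by simpa using hz)]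
    exact h2
  rw [h1.mdifferentiableAt_iff, mdifferentiableAt_iff_chart hq]
  rfl

end Chart
end Centroaffine
end

/-! ### The induced connection and the centroaffine metric read in a chart. -/

noncomputable section

namespace Centroaffine

section Hypersurface

variable {n : ℕ} {M : Type*} [TopologicalSpace M] [ChartedSpace (Model n) M]
  [IsManifold (𝓡 n) ∞ M]

/-- The immersion read in the chart around `p₀`. -/
def chartMap (x : M → Model (n + 1)) (p₀ : M) : Model n → Model (n + 1) :=
  x ∘ (extChartAt (𝓡 n) p₀).symm

variable {x : M → Model (n + 1)} {ε : ℝ} (hx : IsHypersurface x) (hε : ε ≠ 0) {p₀ q : M}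

include hx

omit hx in
theorem contDiffOn_comp_chart_symm {V : Type*} [NormedAddCommGroup V] [NormedSpace ℝ V] {φ : M → V}
    (hφ : ContMDiff (𝓡 n) 𝓘(ℝ, V) ∞ φ) (p₀ : M) :
    ContDiffOn ℝ ∞ (φ ∘ (extChartAt (𝓡 n) p₀).symm) (extChartAt (𝓡 n) p₀).target := by
  rw [← contMDiffOn_iff_contDiffOn]
  exact hφ.comp_contMDiffOn (contMDiffOn_extChartAt_symm p₀)

omit [IsManifold (𝓡 n) ∞ M] in
theorem IsHypersurface.mdifferentiableAt (p : M) :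
    MDifferentiableAt (𝓡 n) 𝓘(ℝ, Model (n + 1)) x p :=
  hx.smooth.mdifferentiableAt (by simp)

theorem contDiffOn_chartMap (p₀ : M) :
    ContDiffOn ℝ ∞ (chartMap x p₀) (extChartAt (𝓡 n) p₀).target :=
  contDiffOn_comp_chart_symm hx.smooth p₀

theorem mvfderiv_immersion (hq : q ∈ (extChartAt (𝓡 n) p₀).source) (v : TangentSpace (𝓡 n) q) :
    mvfderiv (𝓡 n) x q v =
      fderiv ℝ (chartMap x p₀) (extChartAt (𝓡 n) p₀ q) (chartDeriv p₀ q v) :=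
  mvfderiv_eq_chart hq (hx.mdifferentiableAt q) v

theorem splitting_eq_chart (hq : q ∈ (extChartAt (𝓡 n) p₀).source) (v : TangentSpace (𝓡 n) q)
    (t : ℝ) : splitting x ε q (v, t) =
      coordSplitting (chartMap x p₀) ε (extChartAt (𝓡 n) p₀ q) (chartDeriv p₀ q v, t) := by
  rw [coordSplitting_apply, ← mvfderiv_immersion hx hq]
  rw [chartMap, Function.comp_apply, (extChartAt (𝓡 n) p₀).left_inv hq]
  simp [splitting, smul_smul, sub_eq_add_neg]

include hε

theorem isInvertible_coordSplitting {y : Model n} (hy : y ∈ (extChartAt (𝓡 n) p₀).target) :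
    (coordSplitting (chartMap x p₀) ε y).IsInvertible := by
  set q := (extChartAt (𝓡 n) p₀).symm y with hqdef
  have hq : q ∈ (extChartAt (𝓡 n) p₀).source := (extChartAt (𝓡 n) p₀).map_target hy
  have hyq : extChartAt (𝓡 n) p₀ q = y := (extChartAt (𝓡 n) p₀).right_inv hy
  have hinj : Function.Injective
      (coordSplitting (chartMap x p₀) ε y : Model n × ℝ →ₗ[ℝ] Model (n + 1)) := by
    rw [injective_iff_map_eq_zero]
    rintro ⟨a, t⟩ hat
    obtain ⟨v, rfl⟩ := (isInvertible_chartDeriv hq).surjective a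
    have h1 : coordSplitting (chartMap x p₀) ε y (chartDeriv p₀ q v, t) = 0 := hat
    rw [← hyq, coordSplitting_apply, ← mvfderiv_immersion hx hq, chartMap, Function.comp_apply,
      (extChartAt (𝓡 n) p₀).left_inv hq, sub_eq_zero] at h1
    have ht : t = 0 := by
      by_contra ht
      refine hx.transversal q ⟨(t * ε)⁻¹ • v, ?_⟩
      rw [map_smul, h1, smul_smul, inv_mul_cancel₀ (mul_ne_zero ht hε), one_smul]
    rw [ht, zero_mul, zero_smul] at h1
    have hv : v = 0 := hx.immersion q (by rw [h1, map_zero])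
    rw [hv, ht, map_zero]
    rfl
  have hrank : Module.finrank ℝ (Model n × ℝ) = Module.finrank ℝ (Model (n + 1)) := by simp
  exact ⟨(LinearMap.linearEquivOfInjective _ hinj hrank).toContinuousLinearEquiv, rfl⟩

/-- The product rule for the derivative of x_*(Y), together with injectivity of the splitting,
identifies both components at once. -/
theorem gauss_chart (hq : q ∈ (extChartAt (𝓡 n) p₀).source) {Y : Π p : M, TangentSpace (𝓡 n) p}
    (hY : DiffAt Y q) (v : TangentSpace (𝓡 n) q) :
    (chartDeriv p₀ q (gauss x ε Y q v).1, (gauss x ε Y q v).2) =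
      (fderiv ℝ (chartField p₀ Y) (extChartAt (𝓡 n) p₀ q) (chartDeriv p₀ q v) +
        coordChristoffel (chartMap x p₀) ε (extChartAt (𝓡 n) p₀ q) (chartDeriv p₀ q v)
          (chartDeriv p₀ q (Y q)),
      coordMetric (chartMap x p₀) ε (extChartAt (𝓡 n) p₀ q) (chartDeriv p₀ q v)
        (chartDeriv p₀ q (Y q))) := by
  set y := extChartAt (𝓡 n) p₀ q with hy
  set f := chartMap x p₀
  have hyt : y ∈ (extChartAt (𝓡 n) p₀).target := (extChartAt (𝓡 n) p₀).map_source hq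
  have hS := isInvertible_coordSplitting (p₀ := p₀) hx hε hyt
  have hdY : DifferentiableAt ℝ (chartField p₀ Y) y := (diffAt_iff_chart hq).1 hY
  have hdf : DifferentiableAt ℝ (fderiv ℝ f) y :=
    (((contDiffOn_chartMap hx p₀).fderiv_of_isOpen (m := ∞) (isOpen_extChartAt_target p₀)
      (by simp)).contDiffAt (chart_target_mem_nhds hq)).differentiableAt (by simp)
  have hψ : (fun z => mvfderiv (𝓡 n) x z (Y z)) ∘ (extChartAt (𝓡 n) p₀).symm =ᶠ[𝓝 y]
      fun z => fderiv ℝ f z (chartField p₀ Y z) := by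
    filter_upwards [chart_target_mem_nhds hq] with z hz
    rw [Function.comp_apply, mvfderiv_immersion hx ((extChartAt (𝓡 n) p₀).map_target hz),
      (extChartAt (𝓡 n) p₀).right_inv hz]
    rfl
  have hψd : MDifferentiableAt (𝓡 n) 𝓘(ℝ, Model (n + 1)) (fun z => mvfderiv (𝓡 n) x z (Y z)) q := by
    rw [mdifferentiableAt_iff_chart hq, hψ.differentiableAt_iff]
    exact hdf.clm_apply hdY
  have hSinv : (splitting x ε q).IsInvertible := by
    have h1 : splitting x ε q = (coordSplitting f ε y).comp
        ((chartDeriv p₀ q).prodMap (ContinuousLinearMap.id ℝ ℝ)) := by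
      refine ContinuousLinearMap.ext fun w => ?_
      obtain ⟨v, t⟩ := w
      rw [splitting_eq_chart hx hq]
      rfl
    rw [h1]
    obtain ⟨A, hA⟩ := isInvertible_chartDeriv hq
    refine hS.comp ⟨A.prodCongr (ContinuousLinearEquiv.refl ℝ ℝ), ?_⟩
    rw [← hA]
    rfl
  apply hS.injective
  rw [← splitting_eq_chart hx hq]
  have h2 : splitting x ε q (gauss x ε Y q v) = mvfderiv (𝓡 n) (fun z => mvfderiv (𝓡 n) x z (Y z)) q v :=
    hSinv.self_apply_inverse _
  rw [Prod.mk.eta, h2, mvfderiv_eq_chart hq hψd, hψ.fderiv_eq, fderiv_clm_apply hdf hdY,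
    coordSplitting_apply]
  simp only [_root_.add_apply, ContinuousLinearMap.comp_apply, ContinuousLinearMap.flip_apply,
    map_add]
  rw [fderiv_fderiv_eq hS, hy, chartField_apply Y hq]
  module

theorem chartDeriv_inducedConnection (hq : q ∈ (extChartAt (𝓡 n) p₀).source)
    {Y : Π p : M, TangentSpace (𝓡 n) p} (hY : DiffAt Y q) (v : TangentSpace (𝓡 n) q) :
    chartDeriv p₀ q (inducedConnection x ε Y q v) =
      fderiv ℝ (chartField p₀ Y) (extChartAt (𝓡 n) p₀ q) (chartDeriv p₀ q v) +
        coordChristoffel (chartMap x p₀) ε (extChartAt (𝓡 n) p₀ q) (chartDeriv p₀ q v)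
          (chartDeriv p₀ q (Y q)) :=
  congrArg Prod.fst (gauss_chart hx hε hq hY v)

omit hx hε in
theorem diffAt_extend (v : TangentSpace (𝓡 n) q) : DiffAt (FiberBundle.extend (Model n) v) q :=
  FiberBundle.mdifferentiableAt_extend (𝓡 n) (Model n) v

theorem metric_eq_chart (hq : q ∈ (extChartAt (𝓡 n) p₀).source) (v w : TangentSpace (𝓡 n) q) :
    metric x ε q v w = coordMetric (chartMap x p₀) ε (extChartAt (𝓡 n) p₀ q) (chartDeriv p₀ q v)
      (chartDeriv p₀ q w) := by
  have h1 := congrArg Prod.snd (gauss_chart hx hε hq (diffAt_extend w) v)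
  rw [FiberBundle.extend_apply_self] at h1
  exact h1

theorem localGeometry_chart (hpos : IsPositive x ε) (p₀ : M) :
    LocalGeometry ε (extChartAt (𝓡 n) p₀).target (coordMetric (chartMap x p₀) ε)
      (fun y => coordChristoffel (chartMap x p₀) ε y - coordDifference (chartMap x p₀) ε y)
      (coordDifference (chartMap x p₀) ε) := by
  refine localGeometry_of_immersion (isOpen_extChartAt_target p₀) (contDiffOn_chartMap hx p₀)
    (fun y hy => isInvertible_coordSplitting hx hε hy) fun y hy v hv => ?_
  have hq := (extChartAt (𝓡 n) p₀).map_target hy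
  obtain ⟨w, rfl⟩ := (isInvertible_chartDeriv hq).surjective v
  have h1 := hpos _ w (by rintro rfl; exact hv (map_zero _))
  rwa [metric_eq_chart hx hε hq, (extChartAt (𝓡 n) p₀).right_inv hy] at h1

end Hypersurface
end Centroaffine
end

/-! ### Existence and uniqueness of the Levi-Civita connection, and the difference tensor in a
chart. -/

noncomputable section

namespace Centroaffine

section LeviCivita

variable {n : ℕ} {M : Type*} [TopologicalSpace M] [ChartedSpace (Model n) M]
  [IsManifold (𝓡 n) ∞ M]

omit [IsManifold (𝓡 n) ∞ M] in
theorem chartField_add (p₀ : M) (Y Z : Π p : M, TangentSpace (𝓡 n) p) :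
    chartField p₀ (Y + Z) = chartField p₀ Y + chartField p₀ Z := by
  funext y
  exact map_add _ _ _

omit [IsManifold (𝓡 n) ∞ M] in
theorem chartField_smul (p₀ : M) (φ : M → ℝ) (Y : Π p : M, TangentSpace (𝓡 n) p) :
    chartField p₀ (φ • Y) = (φ ∘ (extChartAt (𝓡 n) p₀).symm) • chartField p₀ Y := by
  funext y
  exact (chartDeriv p₀ ((extChartAt (𝓡 n) p₀).symm y)).map_smul _ _

theorem mlieBracket_eq_chart (p : M) (X Y : Π p : M, TangentSpace (𝓡 n) p) :
    chartDeriv p p (VectorField.mlieBracket (𝓡 n) X Y p) =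
      fderiv ℝ (chartField p Y) (extChartAt (𝓡 n) p p) (chartDeriv p p (X p)) -
        fderiv ℝ (chartField p X) (extChartAt (𝓡 n) p p) (chartDeriv p p (Y p)) := by
  have hp := mem_extChartAt_source (I := 𝓡 n) p
  have hfield : ∀ Z : Π p : M, TangentSpace (𝓡 n) p,
      VectorField.mpullbackWithin 𝓘(ℝ, Model n) (𝓡 n) (extChartAt (𝓡 n) p).symm Z
        (Set.range (𝓡 n)) =ᶠ[𝓝 (extChartAt (𝓡 n) p p)] chartField p Z := by
    intro Z
    filter_upwards [chart_target_mem_nhds hp] with z hz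
    have h1 := mfderiv_extChartAt_comp_mfderivWithin_extChartAt_symm (I := 𝓡 n) hz
    have h2 := mfderivWithin_extChartAt_symm_comp_mfderiv_extChartAt (I := 𝓡 n) hz
    rw [VectorField.mpullbackWithin_apply, ContinuousLinearMap.inverse_eq h2 h1]
    rfl
  have hbracket : ∀ P Q : Model n → Model n,
      P =ᶠ[𝓝 (extChartAt (𝓡 n) p p)] chartField p X →
      Q =ᶠ[𝓝 (extChartAt (𝓡 n) p p)] chartField p Y →
      VectorField.lieBracketWithin ℝ P Q
        ((extChartAt (𝓡 n) p).symm ⁻¹' Set.univ ∩ Set.range (𝓡 n)) (extChartAt (𝓡 n) p p) =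
      VectorField.lieBracket ℝ (chartField p X) (chartField p Y) (extChartAt (𝓡 n) p p) := by
    intro P Q hP hQ
    rw [Set.preimage_univ, Set.univ_inter, ModelWithCorners.range_eq_univ,
      VectorField.lieBracketWithin_univ, hP.lieBracket_vectorField_eq hQ]
  let w : Model n :=
    VectorField.lieBracket ℝ (chartField p X) (chartField p Y) (extChartAt (𝓡 n) p p)
  let w' : TangentSpace 𝓘(ℝ, Model n) (extChartAt (𝓡 n) p p) := w
  have h4 : VectorField.mlieBracket (𝓡 n) X Y p =
      (mfderiv (𝓡 n) 𝓘(ℝ, Model n) (extChartAt (𝓡 n) p) p).inverse w' := by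
    rw [← VectorField.mlieBracketWithin_univ]
    exact VectorField.mlieBracketWithin_apply.trans
      (congrArg _ (hbracket _ _ (hfield X) (hfield Y)))
  rw [h4]
  have hA := isInvertible_mfderiv_extChartAt (I := 𝓡 n) hp
  have h3 := hA.self_apply_inverse w'
  rw [← chartField_apply X hp, ← chartField_apply Y hp]
  exact h3

variable {x : M → Model (n + 1)} {ε : ℝ} (hx : IsHypersurface x) (hε : ε ≠ 0)
  (hpos : IsPositive x ε) {p₀ q : M}

/-- The induced connection minus the difference tensor. -/
def levelConnection (x : M → Model (n + 1)) (ε : ℝ) (Y : Π p : M, TangentSpace (𝓡 n) p) (p : M) :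
    TangentSpace (𝓡 n) p →L[ℝ] TangentSpace (𝓡 n) p :=
  letI A : TangentSpace (𝓡 n) p →L[ℝ] TangentSpace (𝓡 n) p :=
    -- The chart derivative of the preferred chart at p is the identity of T_pM, so the coordinate
    -- tensor acts on tangent vectors directly.
    (coordDifference (chartMap x p) ε (extChartAt (𝓡 n) p p)).flip (Y p)
  inducedConnection x ε Y p - A

include hx hε

theorem chartDeriv_levelConnection {p : M} {Y : Π p : M, TangentSpace (𝓡 n) p}
    (hY : DiffAt Y p) (v : TangentSpace (𝓡 n) p) :
    chartDeriv p p (levelConnection x ε Y p v) =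
      fderiv ℝ (chartField p Y) (extChartAt (𝓡 n) p p) (chartDeriv p p v) +
        (coordChristoffel (chartMap x p) ε (extChartAt (𝓡 n) p p) -
          coordDifference (chartMap x p) ε (extChartAt (𝓡 n) p p)) (chartDeriv p p v)
            (chartDeriv p p (Y p)) := by
  have h1 := chartDeriv_inducedConnection hx hε (mem_extChartAt_source (I := 𝓡 n) p) hY v
  have h2 : chartDeriv p p (levelConnection x ε Y p v) =
      chartDeriv p p (inducedConnection x ε Y p v) -
        coordDifference (chartMap x p) ε (extChartAt (𝓡 n) p p) (chartDeriv p p v)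
          (chartDeriv p p (Y p)) := by
    simp only [chartDeriv_self]
    rfl
  rw [h2, h1]
  simp only [_root_.sub_apply]
  abel

include hpos

theorem mvfderiv_metric_chart (hq : q ∈ (extChartAt (𝓡 n) p₀).source)
    {Y Z : Π p : M, TangentSpace (𝓡 n) p} (hY : DiffAt Y q) (hZ : DiffAt Z q)
    (v : TangentSpace (𝓡 n) q) :
    mvfderiv (𝓡 n) (fun z => metric x ε z (Y z) (Z z)) q v =
      coordMetric (chartMap x p₀) ε (extChartAt (𝓡 n) p₀ q)
        (fderiv ℝ (chartField p₀ Y) (extChartAt (𝓡 n) p₀ q) (chartDeriv p₀ q v) +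
          (coordChristoffel (chartMap x p₀) ε (extChartAt (𝓡 n) p₀ q) -
            coordDifference (chartMap x p₀) ε (extChartAt (𝓡 n) p₀ q)) (chartDeriv p₀ q v)
              (chartDeriv p₀ q (Y q))) (chartDeriv p₀ q (Z q)) +
      coordMetric (chartMap x p₀) ε (extChartAt (𝓡 n) p₀ q) (chartDeriv p₀ q (Y q))
        (fderiv ℝ (chartField p₀ Z) (extChartAt (𝓡 n) p₀ q) (chartDeriv p₀ q v) +
          (coordChristoffel (chartMap x p₀) ε (extChartAt (𝓡 n) p₀ q) -
            coordDifference (chartMap x p₀) ε (extChartAt (𝓡 n) p₀ q)) (chartDeriv p₀ q v)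
              (chartDeriv p₀ q (Z q))) := by
  have hL := localGeometry_chart hx hε hpos p₀
  have hyt := (extChartAt (𝓡 n) p₀).map_source hq
  have hdY := (diffAt_iff_chart hq).1 hY
  have hdZ := (diffAt_iff_chart hq).1 hZ
  have h1 : (fun z => metric x ε z (Y z) (Z z)) ∘ (extChartAt (𝓡 n) p₀).symm
      =ᶠ[𝓝 (extChartAt (𝓡 n) p₀ q)]
      fun y => coordMetric (chartMap x p₀) ε y (chartField p₀ Y y) (chartField p₀ Z y) := by
    filter_upwards [chart_target_mem_nhds hq] with z hz
    rw [Function.comp_apply, metric_eq_chart hx hε ((extChartAt (𝓡 n) p₀).map_target hz),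
      (extChartAt (𝓡 n) p₀).right_inv hz]
    rfl
  have h2 : MDifferentiableAt (𝓡 n) 𝓘(ℝ, ℝ) (fun z => metric x ε z (Y z) (Z z)) q := by
    rw [mdifferentiableAt_iff_chart hq, h1.differentiableAt_iff]
    exact hasFDerivAt_clm_apply₂ (hL.differentiableAt_g hyt) hdY hdZ
  rw [mvfderiv_eq_chart hq h2, h1.fderiv_eq, hL.fderiv_metric hyt hdY hdZ,
    chartField_apply Y hq, chartField_apply Z hq]

/-- This is the witness that makes the choice in `leviCivita` meaningful. -/
theorem isLeviCivita_levelConnection : IsLeviCivita (metric x ε) (levelConnection x ε) where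
  covariant := by
    constructor
    · intro Y Z p hY hZ _
      have hp := mem_extChartAt_source (I := 𝓡 n) p
      have hY' : DiffAt Y p := hY
      have hZ' : DiffAt Z p := hZ
      have hdY := (diffAt_iff_chart hp).1 hY'
      have hdZ := (diffAt_iff_chart hp).1 hZ'
      have hYZ : DiffAt (Y + Z) p := by
        rw [diffAt_iff_chart hp, chartField_add]
        exact hdY.add hdZ
      refine ContinuousLinearMap.ext fun v => (isInvertible_chartDeriv hp).injective ?_
      rw [_root_.add_apply, map_add, chartDeriv_levelConnection hx hε hY',
        chartDeriv_levelConnection hx hε hZ', chartDeriv_levelConnection hx hε hYZ,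
        chartField_add, fderiv_add hdY hdZ, Pi.add_apply, map_add, map_add, _root_.add_apply]
      abel
    · intro Y φ p hY hφ _
      have hp := mem_extChartAt_source (I := 𝓡 n) p
      have hY' : DiffAt Y p := hY
      have hdY := (diffAt_iff_chart hp).1 hY'
      have hdφ := (mdifferentiableAt_iff_chart hp).1 hφ
      have hφY : DiffAt (φ • Y) p := by
        rw [diffAt_iff_chart hp, chartField_smul]
        exact hdφ.smul hdY
      refine ContinuousLinearMap.ext fun v => (isInvertible_chartDeriv hp).injective ?_
      rw [_root_.add_apply, map_add, chartDeriv_levelConnection hx hε hφY,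
        ContinuousLinearMap.smulRight_apply, _root_.smul_apply, map_smul, map_smul,
        chartDeriv_levelConnection hx hε hY', chartField_smul, fderiv_smul hdφ hdY,
        mvfderiv_eq_chart hp hφ, Pi.smul_apply', map_smul, map_smul, Function.comp_apply,
        (extChartAt (𝓡 n) p).left_inv hp, chartField_apply Y hp]
      simp only [_root_.add_apply, _root_.smul_apply, ContinuousLinearMap.smulRight_apply]
      module
  torsion_free := by
    intro p X Y hX hY
    have hp := mem_extChartAt_source (I := 𝓡 n) p
    refine (isInvertible_chartDeriv hp).injective ?_
    rw [map_sub, chartDeriv_levelConnection hx hε hX, chartDeriv_levelConnection hx hε hY,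
      mlieBracket_eq_chart,
      (localGeometry_chart hx hε hpos p).G_symm _ (mem_extChartAt_target p)
        (chartDeriv p p (X p)) (chartDeriv p p (Y p))]
    abel
  compatible := by
    intro p Y Z v hY hZ
    have hp := mem_extChartAt_source (I := 𝓡 n) p
    rw [mvfderiv_metric_chart hx hε hpos hp hY hZ, metric_eq_chart hx hε hp,
      metric_eq_chart hx hε hp, chartDeriv_levelConnection hx hε hY,
      chartDeriv_levelConnection hx hε hZ]

theorem isLeviCivita_leviCivita : IsLeviCivita (metric x ε) (leviCivita x ε) :=
  Classical.epsilon_spec ⟨_, isLeviCivita_levelConnection hx hε hpos⟩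

/-- In the preferred chart at q the bracket is ∇_X Y − ∇_Y X for the torsion free induced
connection. That expression does not depend on a chart, so it can be read in any chart containing q.
-/
theorem mlieBracket_eq_chart' (hq : q ∈ (extChartAt (𝓡 n) p₀).source)
    {X Y : Π p : M, TangentSpace (𝓡 n) p} (hX : DiffAt X q) (hY : DiffAt Y q) :
    chartDeriv p₀ q (VectorField.mlieBracket (𝓡 n) X Y q) =
      fderiv ℝ (chartField p₀ Y) (extChartAt (𝓡 n) p₀ q) (chartDeriv p₀ q (X q)) -
        fderiv ℝ (chartField p₀ X) (extChartAt (𝓡 n) p₀ q) (chartDeriv p₀ q (Y q)) := by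
  have hΓ : ∀ p : M, ∀ y ∈ (extChartAt (𝓡 n) p).target, ∀ v w,
      coordChristoffel (chartMap x p) ε y v w = coordChristoffel (chartMap x p) ε y w v := by
    intro p y hy v w
    have h1 := (localGeometry_chart hx hε hpos p).G_symm y hy v w
    have h2 := (localGeometry_chart hx hε hpos p).K_symm y hy v w
    simp only [_root_.sub_apply, h2] at h1
    exact sub_left_injective h1
  have hqq := mem_extChartAt_source (I := 𝓡 n) q
  have h1 : VectorField.mlieBracket (𝓡 n) X Y q =
      inducedConnection x ε Y q (X q) - inducedConnection x ε X q (Y q) := by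
    refine (isInvertible_chartDeriv hqq).injective ?_
    rw [map_sub, mlieBracket_eq_chart, chartDeriv_inducedConnection hx hε hqq hX,
      chartDeriv_inducedConnection hx hε hqq hY, hΓ q _ (mem_extChartAt_target q)
        (chartDeriv q q (X q))]
    abel
  rw [h1, map_sub, chartDeriv_inducedConnection hx hε hq hX,
    chartDeriv_inducedConnection hx hε hq hY, hΓ p₀ _ ((extChartAt (𝓡 n) p₀).map_source hq)
      (chartDeriv p₀ q (X q))]
  abel

/-- Uniqueness in Koszul's manner: the discrepancy `S` is symmetric because both connections are
torsion free, and each S(X, ·) is skew because both are metric, so it vanishes. -/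
theorem chartDeriv_leviCivita (hq : q ∈ (extChartAt (𝓡 n) p₀).source)
    {Y : Π p : M, TangentSpace (𝓡 n) p} (hY : DiffAt Y q) (v : TangentSpace (𝓡 n) q) :
    chartDeriv p₀ q (leviCivita x ε Y q v) =
      fderiv ℝ (chartField p₀ Y) (extChartAt (𝓡 n) p₀ q) (chartDeriv p₀ q v) +
        (coordChristoffel (chartMap x p₀) ε (extChartAt (𝓡 n) p₀ q) -
          coordDifference (chartMap x p₀) ε (extChartAt (𝓡 n) p₀ q)) (chartDeriv p₀ q v)
            (chartDeriv p₀ q (Y q)) := by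
  have hLC := isLeviCivita_leviCivita hx hε hpos
  have hL := localGeometry_chart hx hε hpos p₀
  have hyt := (extChartAt (𝓡 n) p₀).map_source hq
  set y := extChartAt (𝓡 n) p₀ q with hy
  set g := coordMetric (chartMap x p₀) ε y with hg
  set G := coordChristoffel (chartMap x p₀) ε y - coordDifference (chartMap x p₀) ε y with hG
  set A := chartDeriv (n := n) p₀ q
  let S : (Π p : M, TangentSpace (𝓡 n) p) → (Π p : M, TangentSpace (𝓡 n) p) → Model n := fun X Z =>
    A (leviCivita x ε Z q (X q)) - (fderiv ℝ (chartField p₀ Z) y (A (X q)) + G (A (X q)) (A (Z q)))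
  have hSsymm : ∀ X Z, DiffAt X q → DiffAt Z q → S X Z = S Z X := by
    intro X Z hX hZ
    have h1 := congrArg A (hLC.torsion_free q X Z hX hZ)
    rw [map_sub, mlieBracket_eq_chart' hx hε hpos hq hX hZ] at h1
    have h2 : G (A (X q)) (A (Z q)) = G (A (Z q)) (A (X q)) := hL.G_symm y hyt _ _
    simp only [S]
    rw [h2]
    linear_combination (norm := module) h1
  have hgsymm : ∀ a b, g a b = g b a := hL.g_symm y hyt
  have hSskew : ∀ X Z W, DiffAt X q → DiffAt Z q → DiffAt W q →
      g (S X Z) (A (W q)) = -g (S X W) (A (Z q)) := by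
    intro X Z W hX hZ hW
    have h1 := hLC.compatible q Z W (X q) hZ hW
    rw [mvfderiv_metric_chart hx hε hpos hq hZ hW, metric_eq_chart hx hε hq,
      metric_eq_chart hx hε hq] at h1
    simp only [S, map_sub, _root_.sub_apply]
    rw [hgsymm (A (leviCivita x ε W q (X q))), hgsymm (_ + _) (A (Z q))]
    linear_combination -h1
  have hS : ∀ X Z W, DiffAt X q → DiffAt Z q → DiffAt W q → g (S X Z) (A (W q)) = 0 := by
    intro X Z W hX hZ hW
    have e1 := hSskew X Z W hX hZ hW
    -- Alternating the symmetry and the skewness three times each returns to the starting expression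
    -- with the opposite sign.
    rw [hSsymm X W hX hW, hSskew W X Z hW hX hZ, hSsymm W Z hW hZ, hSskew Z W X hZ hW hX,
      hSsymm Z X hZ hX] at e1
    linarith
  have h0 : S (FiberBundle.extend (Model n) v) Y = 0 := by
    refine hL.eq_of_forall hyt fun w => ?_
    obtain ⟨w, rfl⟩ := (isInvertible_chartDeriv hq).surjective w
    have := hS (FiberBundle.extend (Model n) v) Y (FiberBundle.extend (Model n) w)
      (diffAt_extend v) hY (diffAt_extend w)
    rw [FiberBundle.extend_apply_self] at this
    simpa using this
  simp only [S, FiberBundle.extend_apply_self] at h0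
  exact sub_eq_zero.1 h0

theorem chartDeriv_difference (hq : q ∈ (extChartAt (𝓡 n) p₀).source)
    (v w : TangentSpace (𝓡 n) q) :
    chartDeriv p₀ q (difference x ε q v w) =
      coordDifference (chartMap x p₀) ε (extChartAt (𝓡 n) p₀ q) (chartDeriv p₀ q v)
        (chartDeriv p₀ q w) := by
  rw [difference, map_sub, chartDeriv_inducedConnection hx hε hq (diffAt_extend w),
    chartDeriv_leviCivita hx hε hpos hq (diffAt_extend w), FiberBundle.extend_apply_self]
  simp only [_root_.sub_apply]
  abel

end LeviCivita
end Centroaffine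
end

/-! ### The Tchebychev field and operator in a chart. -/

noncomputable section

namespace Centroaffine

section Tchebychev

variable {n : ℕ} {M : Type*} [TopologicalSpace M] [ChartedSpace (Model n) M]
  [IsManifold (𝓡 n) ∞ M]

theorem sum_proj_single (D : Model n →ₗ[ℝ] Model n) :
    ∑ i : Fin n, EuclideanSpace.proj (𝕜 := ℝ) i (D (EuclideanSpace.single i (1 : ℝ))) =
      LinearMap.trace ℝ (Model n) D := by
  rw [LinearMap.trace_eq_matrix_trace ℝ (EuclideanSpace.basisFun (Fin n) ℝ).toBasis, Matrix.trace]
  refine Finset.sum_congr rfl fun i _ => ?_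
  simp [LinearMap.toMatrix_apply]

/-- The trace in `tchebychevForm` uses the standard basis of T_qM; invariance under conjugation
transports it to a chart around another point. -/
theorem sum_proj_conj (A : Model n ≃ₗ[ℝ] Model n) (B : Model n →L[ℝ] Model n)
    (D : Model n → Model n) (hD : ∀ w, A (D w) = B (A w)) :
    ∑ i : Fin n, EuclideanSpace.proj (𝕜 := ℝ) i (D (EuclideanSpace.single i (1 : ℝ))) =
      traceL (Model n) B := by
  have h1 : D = A.symm.conj (B : Model n →ₗ[ℝ] Model n) := by
    funext w
    simp [LinearEquiv.conj_apply, ← hD]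
  rw [h1, sum_proj_single, LinearMap.trace_conj', traceL_apply]

/-- The Tchebychev vector field, in coordinates. -/
def coordTchebychev (f : Model n → Model (n + 1)) (ε : ℝ) (y : Model n) : Model n :=
  (coordMetric f ε y).inverse ((1 / n : ℝ) • (traceL (Model n)).comp (coordDifference f ε y))

variable {x : M → Model (n + 1)} {ε : ℝ} (hx : IsHypersurface x) (hε : ε ≠ 0)
  (hpos : IsPositive x ε) {p₀ q : M}

include hx hε hpos

theorem tchebychevForm_eq_chart (hq : q ∈ (extChartAt (𝓡 n) p₀).source)
    (v : TangentSpace (𝓡 n) q) : tchebychevForm x ε q v = (1 / n : ℝ) * traceL (Model n)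
      (coordDifference (chartMap x p₀) ε (extChartAt (𝓡 n) p₀ q) (chartDeriv p₀ q v)) := by
  obtain ⟨A, hA⟩ := isInvertible_chartDeriv hq
  have h1 := sum_proj_conj A.toLinearEquiv
    (coordDifference (chartMap x p₀) ε (extChartAt (𝓡 n) p₀ q) (chartDeriv p₀ q v))
    (fun w => difference x ε q v w) (fun w => by
      have h2 := chartDeriv_difference hx hε hpos hq v w
      rw [← hA] at h2 ⊢
      exact h2)
  rw [← h1]
  rfl

theorem coordMetric_coordTchebychev {y : Model n} (hy : y ∈ (extChartAt (𝓡 n) p₀).target)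
    (v : Model n) :
    coordMetric (chartMap x p₀) ε y (coordTchebychev (chartMap x p₀) ε y) v =
      (1 / n : ℝ) * traceL (Model n) (coordDifference (chartMap x p₀) ε y v) := by
  have h1 := isInvertible_of_posDef ((localGeometry_chart hx hε hpos p₀).g_pos y hy)
  rw [coordTchebychev, h1.self_apply_inverse]
  rfl

theorem chartDeriv_tchebychevField (hq : q ∈ (extChartAt (𝓡 n) p₀).source) :
    chartDeriv p₀ q (tchebychevField x ε q) =
      coordTchebychev (chartMap x p₀) ε (extChartAt (𝓡 n) p₀ q) := by
  have hyt := (extChartAt (𝓡 n) p₀).map_source hq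
  have hA := isInvertible_chartDeriv hq
  have hspec : ∀ v, metric x ε q (tchebychevField x ε q) v = tchebychevForm x ε q v := by
    refine Classical.epsilon_spec
      (p := fun t : TangentSpace (𝓡 n) q => ∀ v, metric x ε q t v = tchebychevForm x ε q v) ?_
    obtain ⟨t, ht⟩ := hA.surjective (coordTchebychev (chartMap x p₀) ε (extChartAt (𝓡 n) p₀ q))
    refine ⟨t, fun v => ?_⟩
    rw [metric_eq_chart hx hε hq, ht, tchebychevForm_eq_chart hx hε hpos hq,
      coordMetric_coordTchebychev hx hε hpos hyt]
  refine (localGeometry_chart hx hε hpos p₀).eq_of_forall hyt fun w => ?_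
  obtain ⟨v, rfl⟩ := hA.surjective w
  rw [← metric_eq_chart hx hε hq, hspec, tchebychevForm_eq_chart hx hε hpos hq,
    coordMetric_coordTchebychev hx hε hpos hyt]

theorem chartField_tchebychevField {y : Model n} (hy : y ∈ (extChartAt (𝓡 n) p₀).target) :
    chartField p₀ (tchebychevField x ε) y = coordTchebychev (chartMap x p₀) ε y := by
  rw [chartField, chartDeriv_tchebychevField hx hε hpos ((extChartAt (𝓡 n) p₀).map_target hy),
    (extChartAt (𝓡 n) p₀).right_inv hy]

theorem contDiffOn_coordTchebychev (p₀ : M) :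
    ContDiffOn ℝ ∞ (coordTchebychev (chartMap x p₀) ε) (extChartAt (𝓡 n) p₀).target := by
  have hL := localGeometry_chart hx hε hpos p₀
  have hinv : ContDiffOn ℝ ∞ (fun y => (coordMetric (chartMap x p₀) ε y).inverse)
      (extChartAt (𝓡 n) p₀).target := fun y hy =>
    (isInvertible_of_posDef (hL.g_pos y hy)).contDiffAt_map_inverse.comp_contDiffWithinAt y
      (hL.g_smooth y hy)
  exact hinv.clm_apply ((contDiffOn_const.clm_comp hL.K_smooth).const_smul _)

theorem diffAt_tchebychevField (q : M) : DiffAt (tchebychevField x ε) q := by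
  have hq := mem_extChartAt_source (I := 𝓡 n) q
  rw [diffAt_iff_chart hq]
  have h1 : chartField q (tchebychevField x ε) =ᶠ[𝓝 (extChartAt (𝓡 n) q q)]
      coordTchebychev (chartMap x q) ε := by
    filter_upwards [chart_target_mem_nhds hq] with y hy
      using chartField_tchebychevField hx hε hpos hy
  rw [h1.differentiableAt_iff]
  exact ((contDiffOn_coordTchebychev hx hε hpos q).contDiffAt
    (chart_target_mem_nhds hq)).differentiableAt (by simp)

theorem chartDeriv_tchebychevOperator (hq : q ∈ (extChartAt (𝓡 n) p₀).source)
    (v : TangentSpace (𝓡 n) q) : chartDeriv p₀ q (tchebychevOperator x ε q v) =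
      fderiv ℝ (coordTchebychev (chartMap x p₀) ε) (extChartAt (𝓡 n) p₀ q) (chartDeriv p₀ q v) +
        (coordChristoffel (chartMap x p₀) ε (extChartAt (𝓡 n) p₀ q) -
          coordDifference (chartMap x p₀) ε (extChartAt (𝓡 n) p₀ q)) (chartDeriv p₀ q v)
            (coordTchebychev (chartMap x p₀) ε (extChartAt (𝓡 n) p₀ q)) := by
  have h1 : chartField p₀ (tchebychevField x ε) =ᶠ[𝓝 (extChartAt (𝓡 n) p₀ q)]
      coordTchebychev (chartMap x p₀) ε := by
    filter_upwards [chart_target_mem_nhds hq] with y hy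
      using chartField_tchebychevField hx hε hpos hy
  rw [tchebychevOperator, chartDeriv_leviCivita hx hε hpos hq (diffAt_tchebychevField hx hε hpos q),
    h1.fderiv_eq, chartDeriv_tchebychevField hx hε hpos hq]

theorem localTchebychev_chart (hn : n ≠ 0) (hTch : IsTchebychev x ε) {lam : M → ℝ}
    (hlam : ContMDiff (𝓡 n) 𝓘(ℝ, ℝ) ∞ lam)
    (hK : ∀ p : M, difference x ε p (tchebychevField x ε p) (tchebychevField x ε p) =
      lam p • tchebychevField x ε p) (p₀ : M) :
    LocalTchebychev ε (extChartAt (𝓡 n) p₀).target (coordMetric (chartMap x p₀) ε)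
      (fun y => coordChristoffel (chartMap x p₀) ε y - coordDifference (chartMap x p₀) ε y)
      (coordDifference (chartMap x p₀) ε) (coordTchebychev (chartMap x p₀) ε)
      (meanCurvature x ε ∘ (extChartAt (𝓡 n) p₀).symm) (lam ∘ (extChartAt (𝓡 n) p₀).symm) := by
  have hL := localGeometry_chart hx hε hpos p₀
  have hT := contDiffOn_coordTchebychev hx hε hpos p₀
  have hn' : (n : ℝ) ≠ 0 := by exact_mod_cast hn
  have hderiv : ∀ y ∈ (extChartAt (𝓡 n) p₀).target, ∀ v,
      fderiv ℝ (coordTchebychev (chartMap x p₀) ε) y v +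
        (coordChristoffel (chartMap x p₀) ε y - coordDifference (chartMap x p₀) ε y) v
          (coordTchebychev (chartMap x p₀) ε y) =
      (meanCurvature x ε ∘ (extChartAt (𝓡 n) p₀).symm) y • v := by
    intro y hy v
    have hq := (extChartAt (𝓡 n) p₀).map_target hy
    obtain ⟨w, rfl⟩ := (isInvertible_chartDeriv hq).surjective v
    have h1 := chartDeriv_tchebychevOperator hx hε hpos hq w
    rw [hTch, map_smul, (extChartAt (𝓡 n) p₀).right_inv hy] at h1
    exact h1.symm
  -- Smoothness of α is obtained from its expression as the normalised trace of the coordinate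
  -- formula for ∇̂T.
  have hα : ContDiffOn ℝ ∞ (meanCurvature x ε ∘ (extChartAt (𝓡 n) p₀).symm)
      (extChartAt (𝓡 n) p₀).target := by
    have h1 : ContDiffOn ℝ ∞ (fun y => (1 / n : ℝ) * traceL (Model n)
        (fderiv ℝ (coordTchebychev (chartMap x p₀) ε) y +
          (coordChristoffel (chartMap x p₀) ε y - coordDifference (chartMap x p₀) ε y).flip
            (coordTchebychev (chartMap x p₀) ε y))) (extChartAt (𝓡 n) p₀).target := by
      refine contDiffOn_const.mul ((ContinuousLinearMap.contDiff _).comp_contDiffOn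
        ((hT.fderiv_of_isOpen (isOpen_extChartAt_target p₀) (by simp)).add ?_))
      exact ((ContinuousLinearMap.flipₗᵢ ℝ (Model n) (Model n)
        (Model n)).contDiff.comp_contDiffOn hL.G_smooth).clm_apply hT
    refine h1.congr fun y hy => ?_
    have h2 : fderiv ℝ (coordTchebychev (chartMap x p₀) ε) y +
          (coordChristoffel (chartMap x p₀) ε y - coordDifference (chartMap x p₀) ε y).flip
            (coordTchebychev (chartMap x p₀) ε y) =
        (meanCurvature x ε ∘ (extChartAt (𝓡 n) p₀).symm) y • (1 : Model n →L[ℝ] Model n) :=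
      ContinuousLinearMap.ext fun v => hderiv y hy v
    rw [h2, map_smul, traceL_one, finrank_euclideanSpace_fin, smul_eq_mul]
    field_simp
  refine ⟨hL, hT, hα, contDiffOn_comp_chart_symm hlam p₀, ?_, ?_, ?_⟩
  · intro y hy v
    rw [coordMetric_coordTchebychev hx hε hpos hy, finrank_euclideanSpace_fin]
    field_simp
  · intro y hy v
    rw [← hderiv y hy v]
    simp
  · intro y hy
    have hq := (extChartAt (𝓡 n) p₀).map_target hy
    have h1 := congrArg (chartDeriv p₀ ((extChartAt (𝓡 n) p₀).symm y))
      (hK ((extChartAt (𝓡 n) p₀).symm y))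
    rw [map_smul, chartDeriv_difference hx hε hpos hq, chartDeriv_tchebychevField hx hε hpos hq,
      (extChartAt (𝓡 n) p₀).right_inv hy] at h1
    exact h1

end Tchebychev
end Centroaffine
end

/-! ### Scalar functions on the manifold: local and global constancy from vanishing derivatives. -/

noncomputable section

namespace Centroaffine

section ScalarFunctions

variable {n : ℕ} {M : Type*} [TopologicalSpace M] [ChartedSpace (Model n) M]
  [IsManifold (𝓡 n) ∞ M] {φ ψ : M → ℝ} {p : M}

omit [IsManifold (𝓡 n) ∞ M] in
theorem contMDiff_of_chart
    (h : ∀ p : M, ContDiffOn ℝ ∞ (φ ∘ (extChartAt (𝓡 n) p).symm) (extChartAt (𝓡 n) p).target) :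
    ContMDiff (𝓡 n) 𝓘(ℝ, ℝ) ∞ φ := by
  intro p
  have hp := mem_extChartAt_source (I := 𝓡 n) p
  have h1 : ContMDiffAt (𝓡 n) 𝓘(ℝ, ℝ) ∞
      ((φ ∘ (extChartAt (𝓡 n) p).symm) ∘ extChartAt (𝓡 n) p) p :=
    ((h p).contDiffAt (chart_target_mem_nhds hp)).contMDiffAt.comp p contMDiffAt_extChartAt
  refine h1.congr_of_eventuallyEq ?_
  filter_upwards [chart_source_mem_nhds hp] with z hz
  simp only [Function.comp_apply, (extChartAt (𝓡 n) p).left_inv hz]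

theorem fderiv_chart_symm_eq_zero (hφ : ContMDiff (𝓡 n) 𝓘(ℝ, ℝ) ∞ φ) {y : Model n}
    (hy : y ∈ (extChartAt (𝓡 n) p).target)
    (h : ∀ v, mvfderiv (𝓡 n) φ ((extChartAt (𝓡 n) p).symm y) v = 0) :
    fderiv ℝ (φ ∘ (extChartAt (𝓡 n) p).symm) y = 0 := by
  have hq := (extChartAt (𝓡 n) p).map_target hy
  ext w
  obtain ⟨v, rfl⟩ := (isInvertible_chartDeriv hq).surjective w
  have h1 := mvfderiv_eq_chart hq (hφ.mdifferentiableAt (by simp)) v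
  rw [h v, (extChartAt (𝓡 n) p).right_inv hy] at h1
  exact h1.symm

theorem eventually_eq_of_mvfderiv_eq_zero (hφ : ContMDiff (𝓡 n) 𝓘(ℝ, ℝ) ∞ φ)
    (h : ∀ᶠ z in 𝓝 p, ∀ v, mvfderiv (𝓡 n) φ z v = 0) : ∀ᶠ z in 𝓝 p, φ z = φ p := by
  have hp := mem_extChartAt_source (I := 𝓡 n) p
  obtain ⟨r, hr, hball⟩ := Metric.eventually_nhds_iff_ball.1
    (((tendsto_chart_symm hp).eventually h).and
      (Filter.eventually_mem_set.2 (chart_target_mem_nhds hp)))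
  filter_upwards [(tendsto_chart hp).eventually (Metric.ball_mem_nhds _ hr),
    chart_source_mem_nhds hp] with z hz hzs
  have h1 := (convex_ball (extChartAt (𝓡 n) p p) r).is_const_of_fderivWithin_eq_zero (𝕜 := ℝ)
    (f := φ ∘ (extChartAt (𝓡 n) p).symm) (x := extChartAt (𝓡 n) p z) (y := extChartAt (𝓡 n) p p)
    (fun y hy => (((contDiffOn_comp_chart_symm hφ p).differentiableOn (by simp)) y
      (hball y hy).2).mono fun w hw => (hball w hw).2) (fun y hy => by
      rw [fderivWithin_of_isOpen Metric.isOpen_ball hy]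
      exact fderiv_chart_symm_eq_zero hφ (hball y hy).2 (hball y hy).1) hz
      (Metric.mem_ball_self hr)
  simpa only [Function.comp_apply, (extChartAt (𝓡 n) p).left_inv hzs,
    (extChartAt (𝓡 n) p).left_inv hp] using h1

omit [IsManifold (𝓡 n) ∞ M] in
theorem mvfderiv_eq_zero_of_eventually_const {c : ℝ} (h : ∀ᶠ z in 𝓝 p, φ z = c)
    (v : TangentSpace (𝓡 n) p) : mvfderiv (𝓡 n) φ p v = 0 := by
  have h1 : φ =ᶠ[𝓝 p] fun _ => c := h
  have h2 := mvfderiv_const (I := 𝓡 n) (x := p) c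
  rw [mvfderiv, h1.mfderiv_eq]
  exact congrArg (fun A => A v) h2

theorem mvfderiv_eq_zero_of_isLocalMin (hφ : ContMDiff (𝓡 n) 𝓘(ℝ, ℝ) ∞ φ)
    (h : ∀ᶠ z in 𝓝 p, φ p ≤ φ z) (v : TangentSpace (𝓡 n) p) : mvfderiv (𝓡 n) φ p v = 0 := by
  have hp := mem_extChartAt_source (I := 𝓡 n) p
  have h1 : IsLocalMin (φ ∘ (extChartAt (𝓡 n) p).symm) (extChartAt (𝓡 n) p p) := by
    filter_upwards [(tendsto_chart_symm hp).eventually h] with y hy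
    simpa only [Function.comp_apply, (extChartAt (𝓡 n) p).left_inv hp] using hy
  rw [mvfderiv_eq_chart hp (hφ.mdifferentiableAt (by simp)), h1.fderiv_eq_zero]
  rfl

theorem mvfderiv_eq_zero_of_dense (hφ : ContMDiff (𝓡 n) 𝓘(ℝ, ℝ) ∞ φ) {s : Set M} (hs : Dense s)
    (h : ∀ p ∈ s, ∀ v, mvfderiv (𝓡 n) φ p v = 0) (p : M) (v : TangentSpace (𝓡 n) p) :
    mvfderiv (𝓡 n) φ p v = 0 := by
  have hp := mem_extChartAt_source (I := 𝓡 n) p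
  have hcont : ContinuousAt (fderiv ℝ (φ ∘ (extChartAt (𝓡 n) p).symm)) (extChartAt (𝓡 n) p p) :=
    ((contDiffOn_comp_chart_symm hφ p).continuousOn_fderiv_of_isOpen (isOpen_extChartAt_target p)
      (by simp)).continuousAt (chart_target_mem_nhds hp)
  have h1 : fderiv ℝ (φ ∘ (extChartAt (𝓡 n) p).symm) (extChartAt (𝓡 n) p p) = 0 := by
    by_contra hne
    have h2 := (tendsto_chart hp).eventually (hcont.eventually_ne hne)
    obtain ⟨z, hz, hzs⟩ := hs.inter_nhds_nonempty
      (Filter.inter_mem h2 (chart_source_mem_nhds hp))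
    refine hzs.1 (fderiv_chart_symm_eq_zero hφ ((extChartAt (𝓡 n) p).map_source hzs.2) ?_)
    rw [(extChartAt (𝓡 n) p).left_inv hzs.2]
    exact h z hz
  rw [mvfderiv_eq_chart hp (hφ.mdifferentiableAt (by simp)), h1]
  rfl

theorem eq_of_mvfderiv_eq_zero [ConnectedSpace M] (hφ : ContMDiff (𝓡 n) 𝓘(ℝ, ℝ) ∞ φ)
    (h : ∀ (p : M) (v : TangentSpace (𝓡 n) p), mvfderiv (𝓡 n) φ p v = 0) (p q : M) : φ p = φ q :=
  ((IsLocallyConstant.iff_eventually_eq φ).2 fun _ =>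
    eventually_eq_of_mvfderiv_eq_zero hφ (Filter.Eventually.of_forall h)).apply_eq_of_isPreconnected
      isPreconnected_univ (Set.mem_univ p) (Set.mem_univ q)

section Apply

variable (hφ : MDifferentiableAt (𝓡 n) 𝓘(ℝ, ℝ) φ p) (hψ : MDifferentiableAt (𝓡 n) 𝓘(ℝ, ℝ) ψ p)
  (v : TangentSpace (𝓡 n) p)

include hφ

omit [IsManifold (𝓡 n) ∞ M] in
theorem mvfderiv_const_mul_apply (c : ℝ) :
    mvfderiv (𝓡 n) (fun z => c * φ z) p v = c * mvfderiv (𝓡 n) φ p v := by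
  rw [mvfderiv_fun_mul mdifferentiableAt_const hφ, mvfderiv_const, smul_zero, add_zero]
  rfl

include hψ

omit [IsManifold (𝓡 n) ∞ M] in
theorem mvfderiv_add_apply : mvfderiv (𝓡 n) (fun z => φ z + ψ z) p v =
    mvfderiv (𝓡 n) φ p v + mvfderiv (𝓡 n) ψ p v := by
  rw [mvfderiv_fun_add hφ hψ]
  rfl

omit [IsManifold (𝓡 n) ∞ M] in
theorem mvfderiv_sub_apply : mvfderiv (𝓡 n) (fun z => φ z - ψ z) p v =
    mvfderiv (𝓡 n) φ p v - mvfderiv (𝓡 n) ψ p v := by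
  rw [mvfderiv_fun_sub hφ hψ]
  rfl

end Apply

omit [IsManifold (𝓡 n) ∞ M] in
theorem mvfderiv_mul_self_apply (hφ : MDifferentiableAt (𝓡 n) 𝓘(ℝ, ℝ) φ p)
    (v : TangentSpace (𝓡 n) p) :
    mvfderiv (𝓡 n) (fun z => φ z * φ z) p v = 2 * φ p * mvfderiv (𝓡 n) φ p v := by
  rw [mvfderiv_fun_mul hφ hφ, _root_.add_apply, _root_.smul_apply, smul_eq_mul]
  ring

end ScalarFunctions
end Centroaffine
end

/-! ### Transfer of the local identities to the manifold. -/

noncomputable section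

namespace Centroaffine

section EigenTchebychev

variable {n : ℕ} {M : Type*} [TopologicalSpace M] [ChartedSpace (Model n) M]
  [IsManifold (𝓡 n) ∞ M]

/-- A Tchebychev hypersurface with positive definite centroaffine metric and `K_T T = lam T`. -/
structure IsEigenTchebychev (x : M → Model (n + 1)) (ε : ℝ) (lam : M → ℝ) : Prop where
  one_lt : 1 < n
  ε_ne : ε ≠ 0
  hypersurface : IsHypersurface x
  positive : IsPositive x ε
  tchebychev : IsTchebychev x ε
  lam_smooth : ContMDiff (𝓡 n) 𝓘(ℝ, ℝ) ∞ lam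
  eigen : ∀ p, difference x ε p (tchebychevField x ε p) (tchebychevField x ε p) =
    lam p • tchebychevField x ε p

/-- The derivative of `meanCurvature` in the direction of the Tchebychev field. -/
def meanCurvatureDeriv (x : M → Model (n + 1)) (ε : ℝ) (p : M) : ℝ :=
  mvfderiv (𝓡 n) (meanCurvature x ε) p (tchebychevField x ε p)

/-- `spread` as a function on the hypersurface. -/
def spreadField (x : M → Model (n + 1)) (ε : ℝ) (lam : M → ℝ) (p : M) : ℝ :=
  spread n ε (normSqT x ε p) (lam p) (meanCurvatureDeriv x ε p)

namespace IsEigenTchebychev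

variable {x : M → Model (n + 1)} {ε : ℝ} {lam : M → ℝ} (h : IsEigenTchebychev x ε lam)

include h

theorem chart (p₀ : M) :
    LocalTchebychev ε (extChartAt (𝓡 n) p₀).target (coordMetric (chartMap x p₀) ε)
      (fun y => coordChristoffel (chartMap x p₀) ε y - coordDifference (chartMap x p₀) ε y)
      (coordDifference (chartMap x p₀) ε) (coordTchebychev (chartMap x p₀) ε)
      (meanCurvature x ε ∘ (extChartAt (𝓡 n) p₀).symm) (lam ∘ (extChartAt (𝓡 n) p₀).symm) :=
  localTchebychev_chart h.hypersurface h.ε_ne h.positive (Nat.ne_of_gt (zero_lt_one.trans h.one_lt))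
    h.tchebychev h.lam_smooth h.eigen p₀

theorem one_lt_cast : (1 : ℝ) < n := by exact_mod_cast h.one_lt

theorem one_lt_finrank : 1 < Module.finrank ℝ (Model n) := by
  rw [finrank_euclideanSpace_fin]
  exact h.one_lt

theorem contMDiff_meanCurvature : ContMDiff (𝓡 n) 𝓘(ℝ, ℝ) ∞ (meanCurvature x ε) :=
  contMDiff_of_chart fun p => (h.chart p).α_smooth

section Pointwise

variable {p₀ q : M} (hq : q ∈ (extChartAt (𝓡 n) p₀).source)

include hq

theorem metric_chart (v w : TangentSpace (𝓡 n) q) :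
    coordMetric (chartMap x p₀) ε (extChartAt (𝓡 n) p₀ q) (chartDeriv p₀ q v) (chartDeriv p₀ q w) =
      metric x ε q v w :=
  (metric_eq_chart h.hypersurface h.ε_ne hq v w).symm

theorem tchebychevField_chart : coordTchebychev (chartMap x p₀) ε (extChartAt (𝓡 n) p₀ q) =
    chartDeriv p₀ q (tchebychevField x ε q) :=
  (chartDeriv_tchebychevField h.hypersurface h.ε_ne h.positive hq).symm

theorem normSqT_chart : coordMetric (chartMap x p₀) ε (extChartAt (𝓡 n) p₀ q)
    (coordTchebychev (chartMap x p₀) ε (extChartAt (𝓡 n) p₀ q))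
    (coordTchebychev (chartMap x p₀) ε (extChartAt (𝓡 n) p₀ q)) = normSqT x ε q := by
  rw [h.tchebychevField_chart hq, h.metric_chart hq]
  rfl

theorem meanCurvatureDeriv_chart :
    fderiv ℝ (meanCurvature x ε ∘ (extChartAt (𝓡 n) p₀).symm) (extChartAt (𝓡 n) p₀ q)
      (coordTchebychev (chartMap x p₀) ε (extChartAt (𝓡 n) p₀ q)) = meanCurvatureDeriv x ε q := by
  rw [meanCurvatureDeriv, h.tchebychevField_chart hq,
    mvfderiv_eq_chart hq (h.contMDiff_meanCurvature.mdifferentiableAt (by simp))]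

end Pointwise

theorem normSqT_comp_symm (p : M) {y : Model n} (hy : y ∈ (extChartAt (𝓡 n) p).target) :
    (normSqT x ε ∘ (extChartAt (𝓡 n) p).symm) y = coordMetric (chartMap x p) ε y
      (coordTchebychev (chartMap x p) ε y) (coordTchebychev (chartMap x p) ε y) := by
  rw [Function.comp_apply, ← h.normSqT_chart ((extChartAt (𝓡 n) p).map_target hy),
    (extChartAt (𝓡 n) p).right_inv hy]

theorem contMDiff_normSqT : ContMDiff (𝓡 n) 𝓘(ℝ, ℝ) ∞ (normSqT x ε) :=
  contMDiff_of_chart fun p => ContDiffOn.congr (fun _ hy =>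
    ((h.chart p).contDiffAt_normSq hy).contDiffWithinAt) fun _ hy => h.normSqT_comp_symm p hy

theorem contMDiff_meanCurvatureDeriv : ContMDiff (𝓡 n) 𝓘(ℝ, ℝ) ∞ (meanCurvatureDeriv x ε) :=
  contMDiff_of_chart fun p => ContDiffOn.congr (fun _ hy =>
    ((h.chart p).contDiffAt_fderiv_α_T hy).contDiffWithinAt) fun y hy => by
      rw [Function.comp_apply,
        ← h.meanCurvatureDeriv_chart ((extChartAt (𝓡 n) p).map_target hy),
        (extChartAt (𝓡 n) p).right_inv hy]

theorem contMDiff_spreadField : ContMDiff (𝓡 n) 𝓘(ℝ, ℝ) ∞ (spreadField x ε lam) := by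
  have h1 := h.contMDiff_normSqT
  have h2 := h.contMDiff_meanCurvatureDeriv
  have h3 := h.lam_smooth
  have hc : ∀ c : ℝ, ContMDiff (𝓡 n) 𝓘(ℝ, ℝ) ∞ fun _ : M => c := fun c => contMDiff_const
  have h4 := ((hc n).mul h1).sub h3
  exact ((((hc (n - 1)).mul h3).mul h4).sub ((hc ((n - 1) ^ 2)).mul (((hc ε).mul h1).add h2))).sub
    (h4.pow 2)

section AtPoint

variable (p : M)

theorem mvfderiv_normSqT (v : TangentSpace (𝓡 n) p) : mvfderiv (𝓡 n) (normSqT x ε) p v =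
    2 * meanCurvature x ε p * metric x ε p (tchebychevField x ε p) v := by
  have hp := mem_extChartAt_source (I := 𝓡 n) p
  have h1 : normSqT x ε ∘ (extChartAt (𝓡 n) p).symm =ᶠ[𝓝 (extChartAt (𝓡 n) p p)]
      fun y => coordMetric (chartMap x p) ε y (coordTchebychev (chartMap x p) ε y)
        (coordTchebychev (chartMap x p) ε y) := by
    filter_upwards [chart_target_mem_nhds hp] with y hy using h.normSqT_comp_symm p hy
  rw [mvfderiv_eq_chart hp (h.contMDiff_normSqT.mdifferentiableAt (by simp)), h1.fderiv_eq,
    (h.chart p).fderiv_normSq ((extChartAt (𝓡 n) p).map_source hp), h.tchebychevField_chart hp,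
    h.metric_chart hp, Function.comp_apply, (extChartAt (𝓡 n) p).left_inv hp]

theorem mvfderiv_lam (v : TangentSpace (𝓡 n) p) : mvfderiv (𝓡 n) lam p v * normSqT x ε p =
    mvfderiv (𝓡 n) lam p (tchebychevField x ε p) * metric x ε p (tchebychevField x ε p) v := by
  have hp := mem_extChartAt_source (I := 𝓡 n) p
  have h1 := (h.chart p).fderiv_lam ((extChartAt (𝓡 n) p).map_source hp) (chartDeriv p p v)
  rwa [h.normSqT_chart hp, h.tchebychevField_chart hp, h.metric_chart hp,
    ← mvfderiv_eq_chart hp (h.lam_smooth.mdifferentiableAt (by simp)),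
    ← mvfderiv_eq_chart hp (h.lam_smooth.mdifferentiableAt (by simp))] at h1

theorem mvfderiv_meanCurvature (v : TangentSpace (𝓡 n) p) :
    mvfderiv (𝓡 n) (meanCurvature x ε) p v * normSqT x ε p =
      meanCurvatureDeriv x ε p * metric x ε p (tchebychevField x ε p) v := by
  have hp := mem_extChartAt_source (I := 𝓡 n) p
  have h1 := (h.chart p).fderiv_α ((extChartAt (𝓡 n) p).map_source hp) (chartDeriv p p v)
  rwa [h.normSqT_chart hp, h.meanCurvatureDeriv_chart hp, h.tchebychevField_chart hp,
    h.metric_chart hp,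
    ← mvfderiv_eq_chart hp (h.contMDiff_meanCurvature.mdifferentiableAt (by simp))] at h1

theorem three_mul_meanCurvature :
    3 * meanCurvature x ε p * (n * normSqT x ε p) =
      mvfderiv (𝓡 n) lam p (tchebychevField x ε p) + n * meanCurvature x ε p * lam p := by
  have hp := mem_extChartAt_source (I := 𝓡 n) p
  have h1 := (h.chart p).three_mul_α_normSq ((extChartAt (𝓡 n) p).map_source hp)
  rwa [h.normSqT_chart hp, h.tchebychevField_chart hp, finrank_euclideanSpace_fin,
    ← mvfderiv_eq_chart hp (h.lam_smooth.mdifferentiableAt (by simp)), Function.comp_apply,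
    Function.comp_apply, (extChartAt (𝓡 n) p).left_inv hp] at h1

theorem spreadField_mul : spreadField x ε lam p *
    (mvfderiv (𝓡 n) lam p (tchebychevField x ε p) - meanCurvature x ε p * lam p) = 0 := by
  have hp := mem_extChartAt_source (I := 𝓡 n) p
  have h1 := (h.chart p).discriminant_mul ((extChartAt (𝓡 n) p).map_source hp)
  rwa [h.normSqT_chart hp, h.meanCurvatureDeriv_chart hp, h.tchebychevField_chart hp,
    finrank_euclideanSpace_fin,
    ← mvfderiv_eq_chart hp (h.lam_smooth.mdifferentiableAt (by simp)), Function.comp_apply,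
    Function.comp_apply, (extChartAt (𝓡 n) p).left_inv hp] at h1

theorem spread_chart : spread (Module.finrank ℝ (Model n)) ε
    (coordMetric (chartMap x p) ε (extChartAt (𝓡 n) p p)
      (coordTchebychev (chartMap x p) ε (extChartAt (𝓡 n) p p))
      (coordTchebychev (chartMap x p) ε (extChartAt (𝓡 n) p p)))
    ((lam ∘ (extChartAt (𝓡 n) p).symm) (extChartAt (𝓡 n) p p))
    (fderiv ℝ (meanCurvature x ε ∘ (extChartAt (𝓡 n) p).symm) (extChartAt (𝓡 n) p p)
      (coordTchebychev (chartMap x p) ε (extChartAt (𝓡 n) p p))) = spreadField x ε lam p := by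
  have hp := mem_extChartAt_source (I := 𝓡 n) p
  rw [h.normSqT_chart hp, h.meanCurvatureDeriv_chart hp, finrank_euclideanSpace_fin,
    Function.comp_apply, (extChartAt (𝓡 n) p).left_inv hp, spreadField]

theorem normSqT_eq_zero : normSqT x ε p = 0 ↔ tchebychevField x ε p = 0 := by
  constructor
  · intro h0
    by_contra hne
    exact (h.positive p _ hne).ne' h0
  · intro h0
    have hp := mem_extChartAt_source (I := 𝓡 n) p
    rw [← h.normSqT_chart hp, h.tchebychevField_chart hp, h0, map_zero, map_zero]

theorem coordTchebychev_eq_zero {q : M} (hq : q ∈ (extChartAt (𝓡 n) p).source) :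
    coordTchebychev (chartMap x p) ε (extChartAt (𝓡 n) p q) = 0 ↔ tchebychevField x ε q = 0 := by
  rw [h.tchebychevField_chart hq, map_eq_zero_iff _ (isInvertible_chartDeriv hq).injective]

theorem spreadField_nonneg (hT : tchebychevField x ε p ≠ 0) : 0 ≤ spreadField x ε lam p := by
  have hp := mem_extChartAt_source (I := 𝓡 n) p
  rw [← h.spread_chart]
  exact (h.chart p).spread_nonneg ((extChartAt (𝓡 n) p).map_source hp) h.one_lt_finrank
    (mt (h.coordTchebychev_eq_zero p hp).1 hT)

theorem difference_of_spreadField_eq_zero (hT : tchebychevField x ε p ≠ 0)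
    (h0 : spreadField x ε lam p = 0) {v : TangentSpace (𝓡 n) p} (hv : v ∈ orthT x ε p) :
    difference x ε p (tchebychevField x ε p) v =
      ((n * normSqT x ε p - lam p) / (n - 1)) • v := by
  have hp := mem_extChartAt_source (I := 𝓡 n) p
  apply (isInvertible_chartDeriv hp).injective
  have h1 := (h.chart p).K_T_apply_of_spread_eq_zero ((extChartAt (𝓡 n) p).map_source hp)
    h.one_lt_finrank (mt (h.coordTchebychev_eq_zero p hp).1 hT) (by rw [h.spread_chart, h0])
    (v := chartDeriv p p v) (by rw [h.tchebychevField_chart hp, h.metric_chart hp]; exact hv)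
  rw [h.normSqT_chart hp, h.tchebychevField_chart hp, finrank_euclideanSpace_fin,
    Function.comp_apply, (extChartAt (𝓡 n) p).left_inv hp] at h1
  rw [map_smul, chartDeriv_difference h.hypersurface h.ε_ne h.positive hp, h1]

theorem eigenvalue_iff (hT : tchebychevField x ε p ≠ 0) (h0 : spreadField x ε lam p ≠ 0) (c : ℝ) :
    (∃ v ∈ orthT x ε p, v ≠ 0 ∧ difference x ε p (tchebychevField x ε p) v = c • v) ↔
      c ^ 2 - lam p * c + (ε * normSqT x ε p + meanCurvatureDeriv x ε p) = 0 := by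
  have hp := mem_extChartAt_source (I := 𝓡 n) p
  have hinv := isInvertible_chartDeriv hp
  have h1 := (h.chart p).eigenvalue_iff_of_spread_ne_zero ((extChartAt (𝓡 n) p).map_source hp)
    (mt (h.coordTchebychev_eq_zero p hp).1 hT) (by rwa [h.spread_chart]) c
  rw [h.normSqT_chart hp, h.meanCurvatureDeriv_chart hp, h.tchebychevField_chart hp,
    Function.comp_apply, (extChartAt (𝓡 n) p).left_inv hp] at h1
  rw [← h1, hinv.surjective.exists]
  refine exists_congr fun v => and_congr ?_ (and_congr ?_ ?_)
  · rw [h.metric_chart hp]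
    rfl
  · rw [Ne, Ne, map_eq_zero_iff _ hinv.injective]
  · rw [← chartDeriv_difference h.hypersurface h.ε_ne h.positive hp, ← map_smul,
      hinv.injective.eq_iff]

theorem eventually_eq_zero (hT : tchebychevField x ε p = 0) (hα : meanCurvature x ε p = 0) :
    ∀ᶠ q in 𝓝 p, tchebychevField x ε q = 0 ∧ meanCurvature x ε q = 0 := by
  have hp := mem_extChartAt_source (I := 𝓡 n) p
  have h1 := (h.chart p).eventually_eq_zero ((extChartAt (𝓡 n) p).map_source hp)
    h.one_lt_finrank ((h.coordTchebychev_eq_zero p hp).2 hT)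
    (by rwa [Function.comp_apply, (extChartAt (𝓡 n) p).left_inv hp])
  filter_upwards [(tendsto_chart hp).eventually h1, chart_source_mem_nhds hp] with q hq hqs
  rwa [h.coordTchebychev_eq_zero p hqs, Function.comp_apply,
    (extChartAt (𝓡 n) p).left_inv hqs] at hq

theorem meanCurvature_eq_zero_of_eventually (hT : ∀ᶠ q in 𝓝 p, tchebychevField x ε q = 0) :
    meanCurvature x ε p = 0 := by
  have hp := mem_extChartAt_source (I := 𝓡 n) p
  have h1 : coordTchebychev (chartMap x p) ε =ᶠ[𝓝 (extChartAt (𝓡 n) p p)] fun _ => 0 := by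
    filter_upwards [(tendsto_chart_symm hp).eventually hT, chart_target_mem_nhds hp] with y hy hyt
    have := (h.coordTchebychev_eq_zero p ((extChartAt (𝓡 n) p).map_target hyt)).2 hy
    rwa [(extChartAt (𝓡 n) p).right_inv hyt] at this
  have hv : EuclideanSpace.single (⟨0, zero_lt_one.trans h.one_lt⟩ : Fin n) (1 : ℝ) ≠ 0 := by simp
  have h2 := (h.chart p).fderiv_T _ ((extChartAt (𝓡 n) p).map_source hp) (EuclideanSpace.single
    (⟨0, zero_lt_one.trans h.one_lt⟩ : Fin n) (1 : ℝ))
  rw [h1.fderiv_eq, h1.eq_of_nhds, map_zero, sub_zero, Function.comp_apply,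
    (extChartAt (𝓡 n) p).left_inv hp, fderiv_fun_const] at h2
  exact (smul_eq_zero.1 h2.symm).resolve_right hv

end AtPoint
end IsEigenTchebychev
end EigenTchebychev
end Centroaffine
end

/-! ### Constancy of the spread and the two global cases. -/

noncomputable section

namespace Centroaffine
namespace IsEigenTchebychev

variable {n : ℕ} {M : Type*} [TopologicalSpace M] [ChartedSpace (Model n) M]
  [IsManifold (𝓡 n) ∞ M] {x : M → Model (n + 1)} {ε : ℝ} {lam : M → ℝ}
  (h : IsEigenTchebychev x ε lam)

include h

theorem isOpen_ne_zero : IsOpen {p : M | tchebychevField x ε p ≠ 0} := by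
  have h1 : {p : M | tchebychevField x ε p ≠ 0} = {p | normSqT x ε p ≠ 0} := by
    ext p
    exact not_congr (h.normSqT_eq_zero p).symm
  rw [h1]
  exact isOpen_ne_fun h.contMDiff_normSqT.continuous continuous_const

/-- The common zero set of T and α is closed, and open by `eventually_eq_zero`; by connectedness a
common zero would force T to vanish identically. -/
theorem meanCurvature_ne_zero [ConnectedSpace M] (hT : ∃ p : M, tchebychevField x ε p ≠ 0) {p : M}
    (hp : tchebychevField x ε p = 0) : meanCurvature x ε p ≠ 0 := by
  intro hα
  have hopen : IsOpen {q : M | tchebychevField x ε q = 0 ∧ meanCurvature x ε q = 0} :=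
    isOpen_iff_mem_nhds.2 fun q hq => h.eventually_eq_zero q hq.1 hq.2
  have hclosed : IsClosed {q : M | tchebychevField x ε q = 0 ∧ meanCurvature x ε q = 0} := by
    refine IsClosed.and ?_ (isClosed_eq h.contMDiff_meanCurvature.continuous continuous_const)
    simp only [← h.normSqT_eq_zero]
    exact isClosed_eq h.contMDiff_normSqT.continuous continuous_const
  have huniv := IsClopen.eq_univ ⟨hclosed, hopen⟩ ⟨p, hp, hα⟩
  obtain ⟨q, hq⟩ := hT
  have hmem : q ∈ {q : M | tchebychevField x ε q = 0 ∧ meanCurvature x ε q = 0} :=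
    huniv ▸ Set.mem_univ q
  exact hq hmem.1

/-- If T vanished near p, then αv = ∇̂_v T = 0 at p, so p would be a common zero of T and α. -/
theorem dense_ne_zero [ConnectedSpace M] (hT : ∃ p : M, tchebychevField x ε p ≠ 0) :
    Dense {p : M | tchebychevField x ε p ≠ 0} := by
  rw [← compl_compl {p : M | tchebychevField x ε p ≠ 0}, ← interior_eq_empty_iff_dense_compl, Set.eq_empty_iff_forall_notMem]
  intro p hp
  have h1 : ∀ᶠ q in 𝓝 p, tchebychevField x ε q = 0 := by
    filter_upwards [mem_interior_iff_mem_nhds.1 hp] with q hq using not_not.1 hq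
  exact h.meanCurvature_ne_zero hT h1.self_of_nhds (h.meanCurvature_eq_zero_of_eventually p h1)

theorem eventually_ne_zero {p : M} (hT : tchebychevField x ε p ≠ 0)
    (hN : spreadField x ε lam p ≠ 0) :
    ∀ᶠ q in 𝓝 p, tchebychevField x ε q ≠ 0 ∧ spreadField x ε lam q ≠ 0 :=
  Filter.Eventually.and (h.isOpen_ne_zero.mem_nhds hT)
    (h.contMDiff_spreadField.continuous.continuousAt.eventually_ne hN)

theorem mvfderiv_lam_of_spreadField_ne_zero {p : M} (hN : spreadField x ε lam p ≠ 0) :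
    mvfderiv (𝓡 n) lam p (tchebychevField x ε p) = meanCurvature x ε p * lam p :=
  sub_eq_zero.1 ((mul_eq_zero.1 (h.spreadField_mul p)).resolve_left hN)

/-- If α ≠ 0, then near p the relations λ' = αλ and 3nαq = λ' + nαλ give 3nq = (n + 1)λ.
Differentiating along T, with q' = 2αq, yields 3nαq = 0, a contradiction. -/
theorem meanCurvature_eq_zero {p : M} (hT : tchebychevField x ε p ≠ 0)
    (hN : spreadField x ε lam p ≠ 0) : meanCurvature x ε p = 0 := by
  by_contra hα
  have hq := (h.normSqT_eq_zero p).not.2 hT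
  have hn := h.one_lt_cast
  have h1 : ∀ᶠ z in 𝓝 p, 3 * n * normSqT x ε z - (n + 1) * lam z = 0 := by
    filter_upwards [h.eventually_ne_zero hT hN,
      h.contMDiff_meanCurvature.continuous.continuousAt.eventually_ne hα] with z hz hαz
    have h2 := h.three_mul_meanCurvature z
    rw [h.mvfderiv_lam_of_spreadField_ne_zero hz.2] at h2
    apply mul_left_cancel₀ hαz
    linear_combination h2
  have h3 := mvfderiv_eq_zero_of_eventually_const h1 (tchebychevField x ε p)
  have hdq : MDifferentiableAt (𝓡 n) 𝓘(ℝ, ℝ) (normSqT x ε) p :=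
    h.contMDiff_normSqT.mdifferentiableAt (by simp)
  have hdl : MDifferentiableAt (𝓡 n) 𝓘(ℝ, ℝ) lam p := h.lam_smooth.mdifferentiableAt (by simp)
  have hdq' : MDifferentiableAt (𝓡 n) 𝓘(ℝ, ℝ) (fun z => 3 * n * normSqT x ε z) p :=
    mdifferentiableAt_const.mul hdq
  have hdl' : MDifferentiableAt (𝓡 n) 𝓘(ℝ, ℝ) (fun z => (n + 1) * lam z) p :=
    mdifferentiableAt_const.mul hdl
  rw [mvfderiv_sub_apply hdq' hdl', mvfderiv_const_mul_apply hdq, mvfderiv_const_mul_apply hdl,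
    h.mvfderiv_normSqT, h.mvfderiv_lam_of_spreadField_ne_zero hN] at h3
  have h4 : metric x ε p (tchebychevField x ε p) (tchebychevField x ε p) = normSqT x ε p := rfl
  rw [h4] at h3
  have h5 := h1.self_of_nhds
  have h6 : 3 * n * meanCurvature x ε p * normSqT x ε p = 0 := by
    linear_combination h3 - meanCurvature x ε p * h5
  have hn0 : (n : ℝ) ≠ 0 := by linarith
  simp [hn0, hα, hq] at h6

theorem mvfderiv_eq_zero_of_meanCurvature {p : M} (hT : tchebychevField x ε p ≠ 0)
    (hα : meanCurvature x ε p = 0) (v : TangentSpace (𝓡 n) p) :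
    mvfderiv (𝓡 n) (normSqT x ε) p v = 0 ∧ mvfderiv (𝓡 n) lam p v = 0 := by
  constructor
  · rw [h.mvfderiv_normSqT, hα]
    ring
  · have h1 := h.three_mul_meanCurvature p
    have h2 := h.mvfderiv_lam p v
    have h3 : mvfderiv (𝓡 n) lam p (tchebychevField x ε p) = 0 := by
      rw [hα] at h1
      linear_combination -h1
    rw [h3, zero_mul] at h2
    exact (mul_eq_zero.1 h2).resolve_right ((h.normSqT_eq_zero p).not.2 hT)

/-- At a zero of the spread with T ≠ 0, nonnegativity makes the point a local minimum. Elsewhere α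
vanishes nearby, so q, λ and T(α), hence the spread, are locally constant. -/
theorem mvfderiv_spreadField {p : M} (hT : tchebychevField x ε p ≠ 0)
    (v : TangentSpace (𝓡 n) p) : mvfderiv (𝓡 n) (spreadField x ε lam) p v = 0 := by
  by_cases hN : spreadField x ε lam p = 0
  · refine mvfderiv_eq_zero_of_isLocalMin h.contMDiff_spreadField ?_ v
    filter_upwards [h.isOpen_ne_zero.mem_nhds hT] with z hz
    rw [hN]
    exact h.spreadField_nonneg z hz
  · have h1 := h.eventually_ne_zero hT hN
    have h2 : ∀ᶠ z in 𝓝 p, meanCurvature x ε z = 0 := by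
      filter_upwards [h1] with z hz using h.meanCurvature_eq_zero hz.1 hz.2
    have h3 : ∀ᶠ z in 𝓝 p, meanCurvatureDeriv x ε z = 0 := by
      filter_upwards [h2.eventually_nhds] with z hz
        using mvfderiv_eq_zero_of_eventually_const hz _
    have h4 := eventually_eq_of_mvfderiv_eq_zero h.contMDiff_normSqT (p := p) (by
      filter_upwards [h1, h2] with z hz hαz v
        using (h.mvfderiv_eq_zero_of_meanCurvature hz.1 hαz v).1)
    have h5 := eventually_eq_of_mvfderiv_eq_zero h.lam_smooth (p := p) (by
      filter_upwards [h1, h2] with z hz hαz v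
        using (h.mvfderiv_eq_zero_of_meanCurvature hz.1 hαz v).2)
    refine mvfderiv_eq_zero_of_eventually_const (c := spreadField x ε lam p) ?_ v
    filter_upwards [h3, h4, h5] with z h3z h4z h5z
    rw [spreadField, spreadField, h3z, h4z, h5z, h3.self_of_nhds]

variable [ConnectedSpace M] (hT : ∃ p : M, tchebychevField x ε p ≠ 0)

include hT

theorem spreadField_eq (p q : M) : spreadField x ε lam p = spreadField x ε lam q :=
  eq_of_mvfderiv_eq_zero h.contMDiff_spreadField
    (mvfderiv_eq_zero_of_dense h.contMDiff_spreadField (h.dense_ne_zero hT)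
      fun _ hp v => h.mvfderiv_spreadField hp v) p q

/-- The case in which the eigenvalues of `K_T` on the complement of `T` are not all equal. -/
theorem parallel_of_spreadField_ne_zero (hN : ∀ p, spreadField x ε lam p ≠ 0) :
    (∀ p : M, tchebychevField x ε p ≠ 0) ∧
      (∀ p : M, leviCivita x ε (tchebychevField x ε) p = 0) ∧
      ∃ μ₁ μ₂ : ℝ, μ₁ ≠ μ₂ ∧ ∀ (p : M) (c : ℝ),
        (∃ v ∈ orthT x ε p, v ≠ 0 ∧ difference x ε p (tchebychevField x ε p) v = c • v) ↔
        (c = μ₁ ∨ c = μ₂) := by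
  -- α vanishes where T ≠ 0, hence everywhere by density; a zero of T would require α ≠ 0 there.
  have hα : ∀ p, meanCurvature x ε p = 0 := by
    have h1 := h.contMDiff_meanCurvature.continuous.ext_on (h.dense_ne_zero hT) continuous_const
      (g := fun _ => 0) fun p hp => h.meanCurvature_eq_zero hp (hN p)
    exact congrFun h1
  have hne : ∀ p : M, tchebychevField x ε p ≠ 0 := fun p hp =>
    h.meanCurvature_ne_zero hT hp (hα p)
  refine ⟨hne, fun p => ?_, ?_⟩
  · refine ContinuousLinearMap.ext fun v => ?_
    have h1 := h.tchebychev p v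
    rw [hα, zero_smul] at h1
    exact h1
  obtain ⟨p₀, hp₀⟩ := hT
  have hq : ∀ p, normSqT x ε p = normSqT x ε p₀ := fun p =>
    eq_of_mvfderiv_eq_zero h.contMDiff_normSqT
      (fun p v => (h.mvfderiv_eq_zero_of_meanCurvature (hne p) (hα p) v).1) p p₀
  have hl : ∀ p, lam p = lam p₀ := fun p =>
    eq_of_mvfderiv_eq_zero h.lam_smooth
      (fun p v => (h.mvfderiv_eq_zero_of_meanCurvature (hne p) (hα p) v).2) p p₀
  have ha : ∀ p, meanCurvatureDeriv x ε p = 0 := fun p =>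
    mvfderiv_eq_zero_of_eventually_const (Filter.Eventually.of_forall hα) _
  set l := lam p₀
  set c₀ := ε * normSqT x ε p₀
  have hdisc : 0 < l ^ 2 - 4 * c₀ := by
    have h1 := lt_of_le_of_ne (h.spreadField_nonneg p₀ hp₀) (hN p₀).symm
    rw [spreadField, spread, ha, add_zero] at h1
    have h2 : (0 : ℝ) < (n - 1) ^ 2 := by
      have := h.one_lt_cast
      have : (0 : ℝ) < n - 1 := by linarith
      positivity
    refine pos_of_mul_pos_right ?_ h2.le
    -- With s = nq − λ, (n − 1)²(λ² − 4c₀) = 4·spread + (2s − (n − 1)λ)².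
    nlinarith [sq_nonneg (2 * (n * normSqT x ε p₀ - l) - (n - 1) * l)]
  refine ⟨(l + Real.sqrt (l ^ 2 - 4 * c₀)) / 2, (l - Real.sqrt (l ^ 2 - 4 * c₀)) / 2, ?_, ?_⟩
  · intro heq
    have := Real.sqrt_pos.2 hdisc
    linarith
  · intro p c
    rw [h.eigenvalue_iff p (hne p) (hN p), ha, hq, hl, add_zero]
    have hs := Real.sq_sqrt hdisc.le
    have h3 : c ^ 2 - l * c + c₀ = (c - (l + Real.sqrt (l ^ 2 - 4 * c₀)) / 2) *
        (c - (l - Real.sqrt (l ^ 2 - 4 * c₀)) / 2) := by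
      linear_combination (1 / 4 : ℝ) * hs
    rw [h3, mul_eq_zero, sub_eq_zero, sub_eq_zero]

/-- The case in which `K_T` is a multiple of the identity on the complement of `T`. -/
theorem umbilic_of_spreadField_eq_zero (hN : ∀ p, spreadField x ε lam p = 0) :
    ∃ μ : M → ℝ,
      ContMDiffOn (𝓡 n) 𝓘(ℝ, ℝ) ∞ μ {p : M | tchebychevField x ε p ≠ 0} ∧
      (∀ p : M, tchebychevField x ε p ≠ 0 →
        (∀ v ∈ orthT x ε p, difference x ε p (tchebychevField x ε p) v = μ p • v) ∧
        mvfderiv (𝓡 n) μ p (tchebychevField x ε p) =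
          (lam p - μ p) * meanCurvature x ε p ∧
        n * normSqT x ε p = lam p + (n - 1) * μ p) ∧
      ∃ c₀ : ℝ, ∀ p : M, tchebychevField x ε p ≠ 0 →
        ε * normSqT x ε p - μ p ^ 2 + meanCurvature x ε p ^ 2 = c₀ := by
  have hn : (n : ℝ) - 1 ≠ 0 := by linarith [h.one_lt_cast]
  set μ : M → ℝ := fun p => (n * normSqT x ε p - lam p) * (1 / (n - 1)) with hμdef
  have hμ : ContMDiff (𝓡 n) 𝓘(ℝ, ℝ) ∞ μ :=
    ((contMDiff_const.mul h.contMDiff_normSqT).sub h.lam_smooth).mul contMDiff_const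
  have hdq : ∀ p, MDifferentiableAt (𝓡 n) 𝓘(ℝ, ℝ) (normSqT x ε) p := fun p =>
    h.contMDiff_normSqT.mdifferentiableAt (by simp)
  have hdl : ∀ p, MDifferentiableAt (𝓡 n) 𝓘(ℝ, ℝ) lam p := fun p =>
    h.lam_smooth.mdifferentiableAt (by simp)
  have hdα : ∀ p, MDifferentiableAt (𝓡 n) 𝓘(ℝ, ℝ) (meanCurvature x ε) p := fun p =>
    h.contMDiff_meanCurvature.mdifferentiableAt (by simp)
  have hdμ : ∀ p, MDifferentiableAt (𝓡 n) 𝓘(ℝ, ℝ) μ p := fun p =>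
    hμ.mdifferentiableAt (by simp)
  have hnq : ∀ p, n * normSqT x ε p = lam p + (n - 1) * μ p := by
    intro p
    rw [hμdef]
    field_simp
    ring
  have hμv : ∀ p v, (n - 1) * mvfderiv (𝓡 n) μ p v =
      n * mvfderiv (𝓡 n) (normSqT x ε) p v - mvfderiv (𝓡 n) lam p v := by
    intro p v
    have h1 : MDifferentiableAt (𝓡 n) 𝓘(ℝ, ℝ) (fun p => n * normSqT x ε p) p :=
      mdifferentiableAt_const.mul (hdq p)
    have h2 : μ = fun p => 1 / (n - 1) * (n * normSqT x ε p - lam p) :=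
      funext fun p => mul_comm _ _
    rw [h2, mvfderiv_const_mul_apply (φ := fun p => n * normSqT x ε p - lam p) (h1.sub (hdl p)),
      mvfderiv_sub_apply h1 (hdl p),
      mvfderiv_const_mul_apply (hdq p)]
    field_simp
  have hμT : ∀ p, mvfderiv (𝓡 n) μ p (tchebychevField x ε p) =
      (lam p - μ p) * meanCurvature x ε p := by
    intro p
    have h1 := hμv p (tchebychevField x ε p)
    have h2 := h.three_mul_meanCurvature p
    have h3 := h.mvfderiv_normSqT p (tchebychevField x ε p)
    have h4 : metric x ε p (tchebychevField x ε p) (tchebychevField x ε p) = normSqT x ε p := rfl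
    rw [h4] at h3
    apply mul_left_cancel₀ hn
    linear_combination h1 + n * h3 + h2 - meanCurvature x ε p * hnq p
  refine ⟨μ, hμ.contMDiffOn, fun p hp => ⟨fun v hv => ?_, hμT p, hnq p⟩, ?_⟩
  · rw [h.difference_of_spreadField_eq_zero p hp (hN p) hv, hμdef, div_eq_mul_one_div]
  -- The differentials of q and of λ are multiples of h(T, ·) where T ≠ 0, hence so is that of μ,
  -- and its value on T fixes the factor.
  have hμ' : ∀ p v, mvfderiv (𝓡 n) μ p v * normSqT x ε p =
      (lam p - μ p) * meanCurvature x ε p * metric x ε p (tchebychevField x ε p) v := by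
    intro p v
    have h1 := hμv p v
    have h2 := hμv p (tchebychevField x ε p)
    have h3 := h.mvfderiv_normSqT p v
    have h4 := h.mvfderiv_normSqT p (tchebychevField x ε p)
    have h5 := h.mvfderiv_lam p v
    have h6 : metric x ε p (tchebychevField x ε p) (tchebychevField x ε p) = normSqT x ε p := rfl
    rw [h6] at h4
    rw [hμT] at h2
    apply mul_left_cancel₀ hn
    rw [h3] at h1
    rw [h4] at h2
    linear_combination normSqT x ε p * h1 -
      metric x ε p (tchebychevField x ε p) v * h2 - h5
  have hf : ContMDiff (𝓡 n) 𝓘(ℝ, ℝ) ∞ fun p =>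
      ε * normSqT x ε p - μ p * μ p + meanCurvature x ε p * meanCurvature x ε p :=
    ((contMDiff_const.mul h.contMDiff_normSqT).sub (hμ.mul hμ)).add
      (h.contMDiff_meanCurvature.mul h.contMDiff_meanCurvature)
  have hconst := eq_of_mvfderiv_eq_zero hf (mvfderiv_eq_zero_of_dense hf (h.dense_ne_zero hT) (by
    intro p hp v
    have hq := (h.normSqT_eq_zero p).not.2 hp
    have h1 : MDifferentiableAt (𝓡 n) 𝓘(ℝ, ℝ) (fun p => ε * normSqT x ε p) p :=
      mdifferentiableAt_const.mul (hdq p)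
    have h2 : MDifferentiableAt (𝓡 n) 𝓘(ℝ, ℝ) (fun p => μ p * μ p) p := (hdμ p).mul (hdμ p)
    rw [mvfderiv_add_apply (φ := fun p => ε * normSqT x ε p - μ p * μ p)
      (ψ := fun p => meanCurvature x ε p * meanCurvature x ε p) (h1.sub h2) ((hdα p).mul (hdα p)),
      mvfderiv_sub_apply h1 h2,
      mvfderiv_const_mul_apply (hdq p), mvfderiv_mul_self_apply (hdμ p),
      mvfderiv_mul_self_apply (hdα p)]
    have h3 := h.mvfderiv_normSqT p v
    have h4 := hμ' p v
    have h5 := h.mvfderiv_meanCurvature p v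
    have h6 := hN p
    rw [spreadField, spread, hnq] at h6
    -- For s = (n − 1)μ the spread equals (n − 1)²(μ(λ − μ) − εq − T(α)). Its vanishing is exactly
    -- what cancels the derivative of εq − μ² + α², whose value on v is a multiple of α·h(T, v).
    have h7 : ε * normSqT x ε p + meanCurvatureDeriv x ε p - μ p * (lam p - μ p) = 0 := by
      apply mul_left_cancel₀ (pow_ne_zero 2 hn)
      linear_combination -h6
    apply mul_right_cancel₀ hq
    linear_combination ε * normSqT x ε p * h3 - 2 * μ p * h4 + 2 * meanCurvature x ε p * h5 +
      2 * meanCurvature x ε p * metric x ε p (tchebychevField x ε p) v * h7))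
  obtain ⟨p₀, -⟩ := hT
  refine ⟨ε * normSqT x ε p₀ - μ p₀ * μ p₀ + meanCurvature x ε p₀ * meanCurvature x ε p₀,
    fun p _ => ?_⟩
  rw [pow_two, pow_two]
  exact hconst p p₀

end IsEigenTchebychev
end Centroaffine
end

/-! ### The dichotomy, decided by whether the constant spread is zero. -/

theorem proposition3p1 {n : ℕ} (hn : 3 ≤ n)
    {M : Type*} [TopologicalSpace M] [T2Space M] [SecondCountableTopology M] [ConnectedSpace M]
    [ChartedSpace (EuclideanSpace ℝ (Fin n)) M] [IsManifold (𝓡 n) ∞ M]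
    (x : M → EuclideanSpace ℝ (Fin (n + 1))) (ε : ℝ) (hε : ε = 1 ∨ ε = -1)
    (hx : Centroaffine.IsHypersurface x)
    (hpos : Centroaffine.IsPositive x ε)
    (hTch : Centroaffine.IsTchebychev x ε)
    (hT : ∃ p : M, Centroaffine.tchebychevField x ε p ≠ 0)
    (lam : M → ℝ) (hlam : ContMDiff (𝓡 n) 𝓘(ℝ, ℝ) ∞ lam)
    (hK : ∀ p : M, Centroaffine.difference x ε p
      (Centroaffine.tchebychevField x ε p) (Centroaffine.tchebychevField x ε p) =
        lam p • Centroaffine.tchebychevField x ε p) :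
    ((∀ p : M, Centroaffine.tchebychevField x ε p ≠ 0) ∧
      (∀ p : M, Centroaffine.leviCivita x ε (Centroaffine.tchebychevField x ε) p = 0) ∧
      ∃ μ₁ μ₂ : ℝ, μ₁ ≠ μ₂ ∧ ∀ (p : M) (c : ℝ),
        (∃ v ∈ Centroaffine.orthT x ε p, v ≠ 0 ∧
          Centroaffine.difference x ε p (Centroaffine.tchebychevField x ε p) v = c • v) ↔
        (c = μ₁ ∨ c = μ₂)) ∨
    (∃ μ : M → ℝ,
      ContMDiffOn (𝓡 n) 𝓘(ℝ, ℝ) ∞ μ {p : M | Centroaffine.tchebychevField x ε p ≠ 0} ∧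
      (∀ p : M, Centroaffine.tchebychevField x ε p ≠ 0 →
        (∀ v ∈ Centroaffine.orthT x ε p,
          Centroaffine.difference x ε p (Centroaffine.tchebychevField x ε p) v = μ p • v) ∧
        mvfderiv (𝓡 n) μ p (Centroaffine.tchebychevField x ε p) =
          (lam p - μ p) * Centroaffine.meanCurvature x ε p ∧
        n * Centroaffine.normSqT x ε p = lam p + (n - 1) * μ p) ∧
      ∃ c₀ : ℝ, ∀ p : M, Centroaffine.tchebychevField x ε p ≠ 0 →
        ε * Centroaffine.normSqT x ε p - μ p ^ 2 + Centroaffine.meanCurvature x ε p ^ 2 = c₀) := by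
  have h : Centroaffine.IsEigenTchebychev x ε lam :=
    ⟨by omega, by rcases hε with rfl | rfl <;> norm_num, hx, hpos, hTch, hlam, hK⟩
  obtain ⟨p₀, -⟩ := id hT
  by_cases hN : Centroaffine.spreadField x ε lam p₀ = 0
  · exact Or.inr (h.umbilic_of_spreadField_eq_zero hT fun p =>
      (h.spreadField_eq hT p p₀).trans hN)
  · exact Or.inl (h.parallel_of_spreadField_ne_zero hT fun p hp =>
      hN ((h.spreadField_eq hT p₀ p).trans hp))
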